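/- **Model.** Let $n,d\ge 1$, $K_n\in\{1,\dots,n\}$, $K_d\in\{1,\dots,d\}$ be integers and $\lambda\in[0,1]$. Let $S\subset[n]$ and $T\subset[d]$ be random sets such that all the events $\{i\in S\}$ ($i\in[n]$) and $\{k\in T\}$ ($k\in[d]$) are independent, with $\mathbb P(i\in S)=K_n/n$ and $\mathbb P(k\in T)=K_d/d$. Given $(S,T)$, the entries of $Y\in\{-1,1\}^{n\times d}$ are independent with $\mathbb E[Y_{ik}\mid S,T]=\lambda\mathbf 1\{i\in S,\ k\in T\}$. Write $\mathbb E$ for the expectation under the resulting (mixture) law. **Templates.** Consider finite bipartite graphs $G=(V,W,E)$, $E\subset V\times W$, with a distinguished node $v_1\in V$. Two of them are equivalent if there are bijections between the $V$'s and between the $W$'s that map $v_1$ to $v_1$ and preserve edges and non-edges; $\mathrm{Aut}^\star(G)$ is the group of such self-equivalences of $G$. For $D\ge 1$, let $\mathcal G^\star_{\le D}$ be a maximum collection of pairwise non-equivalent graphs $G$ with $1\le |E|\le D$ in which no node, except possibly $v_1$, is isolated. **Polynomials.** Let $G_1,\dots,G_m$ be the connected components of $G$ with at least one edge, with edge sets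 $E_1,\dots,E_m$. For injections $\sigma:V\to[n]$ with $\sigma(v_1)=1$ and $\tau:W\to[d]$ put $P_{G_l,\sigma,\tau}(Y)=\prod_{(v,w)\in E_l}Y_{\sigma(v),\tau(w)}$ and $$\overline P^\star_{G}=\sum_{\sigma,\tau}\ \prod_{l=1}^m\bigl(P_{G_l,\sigma,\tau}-\mathbb E[P_{G_l,\sigma,\tau}]\bigr),\qquad \Psi^\star_G=\frac{\overline P^\star_G}{\sqrt{\mathbb V^\star(G)}},\qquad \mathbb V^\star(G)=\frac{(n-1)!}{(n-|V|)!}\,\frac{d!}{(d-|W|)!}\,|\mathrm{Aut}^\star(G)|,$$ where the sum is over all such pairs $(\sigma,\tau)$. **Theorem.** There is a universal constant $c_0>0$ such that the following holds for every real $c_s\ge c_0$. Let $n,d,K_n,K_d,\lambda$ be as above, let $D\ge 2$ be an integer, and assume $$\frac{K_n}{n}\vee\frac{K_d}{d}\vee\frac{\lambda K_n}{\sqrt n}\vee\frac{\lambda K_d}{\sqrt d}\vee\lambda\ \le\ D^{-8c_s}.$$ Then, for all real coefficients $\alpha_\emptyset$ and $(\alpha_G)_{G\in\mathcal G^\star_{\le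 D}}$, $$(1-D^{-c_s/4})\Bigl[\alpha_\emptyset^2+\sum_{G\in\mathcal G^\star_{\le D}}\alpha_G^2\Bigr]\le \mathbb E\Bigl[\Bigl(\alpha_\emptyset+\sum_{G\in\mathcal G^\star_{\le D}}\alpha_G\Psi^\star_G\Bigr)^2\Bigr]\le (1+D^{-c_s/4})\Bigl[\alpha_\emptyset^2+\sum_{G\in\mathcal G^\star_{\le D}}\alpha_G^2\Bigr].$$ (The hypotheses force $n\ge |V|$ and $d\ge |W|$ for every template, after enlarging $c_0$, so that $\mathbb V^\star(G)$ is well defined.) -/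

import Mathlib

open MeasureTheory

noncomputable section

namespace SubmatrixLD

/-! ### The observation model -/

/-- The law of a `{-1, 1}`-valued variable with mean `m ∈ [-1, 1]`. -/
def signLaw (m : ℝ) : Measure ℝ :=
  ENNReal.ofReal ((1 + m) / 2) • Measure.dirac 1 +
    ENNReal.ofReal ((1 - m) / 2) • Measure.dirac (-1)

/-- The block matrix `lam * 1{S × T}`. -/
def blockMatrix {n d : ℕ} (lam : ℝ) (S : Finset (Fin n)) (T : Finset (Fin d)) :
    Fin n × Fin d → ℝ :=
  fun e => if e.1 ∈ S ∧ e.2 ∈ T then lam else 0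

/-- The law of an `n × d` array of independent signs whose matrix of means is `M`. -/
def condLaw {n d : ℕ} (M : Fin n × Fin d → ℝ) : Measure (Fin n × Fin d → ℝ) :=
  Measure.pi fun e => signLaw (M e)

/-- The probability that a random subset of `Fin m`, containing each point independently with
probability `p`, equals `S`. -/
def bernoulliWeight {m : ℕ} (p : ℝ) (S : Finset (Fin m)) : ℝ :=
  ∏ i, if i ∈ S then p else 1 - p

/-- The mixture law of the observation `Y`: the events `i ∈ S` (probability `Kn / n`) and `k ∈ T`
(probability `Kd / d`) are independent and, given `(S, T)`, the entries of `Y` are independent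
signs with means `lam * 1{i ∈ S, k ∈ T}`. -/
def mixtureLaw (n d Kn Kd : ℕ) (lam : ℝ) : Measure (Fin n × Fin d → ℝ) :=
  ∑ S : Finset (Fin n), ∑ T : Finset (Fin d),
    ENNReal.ofReal (bernoulliWeight ((Kn : ℝ) / n) S * bernoulliWeight ((Kd : ℝ) / d) T) •
      condLaw (blockMatrix lam S T)

/-! ### Rooted bipartite graphs -/

/-- A bipartite graph `(V, W, E)` with `V` nonempty; the distinguished node `v₁` is `0`. -/
structure BiGraph where
  /-- number of nodes of `V` other than `v₁` -/
  r : ℕ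
  /-- number of nodes of `W` -/
  s : ℕ
  /-- the edge set -/
  E : Finset (Fin (r + 1) × Fin s)

namespace BiGraph

/-- At least one edge, at most `D` edges, and no isolated node except possibly `v₁`. -/
def IsTemplate (D : ℕ) (G : BiGraph) : Prop :=
  1 ≤ G.E.card ∧ G.E.card ≤ D ∧
    (∀ v : Fin (G.r + 1), v ≠ 0 → ∃ w, (v, w) ∈ G.E) ∧
    (∀ w : Fin G.s, ∃ v, (v, w) ∈ G.E)

/-- Isomorphism of bipartite graphs respecting the distinguished nodes. -/
def Equivalent (G H : BiGraph) : Prop :=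
  ∃ (f : Fin (G.r + 1) ≃ Fin (H.r + 1)) (g : Fin G.s ≃ Fin H.s),
    f 0 = 0 ∧ ∀ v w, (v, w) ∈ G.E ↔ (f v, g w) ∈ H.E

/-- A maximum collection of pairwise non-equivalent templates with at most `D` edges. -/
def IsTemplateCollection (D : ℕ) (𝒢 : Finset BiGraph) : Prop :=
  (∀ G ∈ 𝒢, G.IsTemplate D) ∧
    (∀ G ∈ 𝒢, ∀ H ∈ 𝒢, G.Equivalent H → G = H) ∧
    ∀ G : BiGraph, G.IsTemplate D → ∃ H ∈ 𝒢, G.Equivalent H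

/-- The number of automorphisms of `G` that fix `v₁`. -/
def autCard (G : BiGraph) : ℕ :=
  Nat.card {f : Equiv.Perm (Fin (G.r + 1)) × Equiv.Perm (Fin G.s) //
    f.1 0 = 0 ∧ ∀ v w, (v, w) ∈ G.E ↔ (f.1 v, f.2 w) ∈ G.E}

/-- The underlying simple graph on the node set `V ⊔ W`. -/
def toSimpleGraph (G : BiGraph) : SimpleGraph (Fin (G.r + 1) ⊕ Fin G.s) :=
  SimpleGraph.fromRel fun x y => ∃ v w, x = Sum.inl v ∧ y = Sum.inr w ∧ (v, w) ∈ G.E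

/-- The connected component that contains the edge `e`. -/
def edgeComponent (G : BiGraph) (e : Fin (G.r + 1) × Fin G.s) :
    G.toSimpleGraph.ConnectedComponent :=
  G.toSimpleGraph.connectedComponentMk (Sum.inl e.1)

open Classical in
/-- The connected components of `G` with at least one edge. -/
def components (G : BiGraph) : Finset G.toSimpleGraph.ConnectedComponent :=
  G.E.image G.edgeComponent

open Classical in
/-- The edges of the connected component `c`. -/
def componentEdges (G : BiGraph) (c : G.toSimpleGraph.ConnectedComponent) :
    Finset (Fin (G.r + 1) × Fin G.s) :=
  G.E.filter fun e => G.edgeComponent e = c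

/-! ### The polynomials -/

/-- The monomial `∏ Y_{σ(v), τ(w)}` over the edges `(v, w)` of the component `c`. -/
def componentMonomial (G : BiGraph) {n d : ℕ} (c : G.toSimpleGraph.ConnectedComponent)
    (σ : Fin (G.r + 1) ↪ Fin n) (τ : Fin G.s ↪ Fin d) (Y : Fin n × Fin d → ℝ) : ℝ :=
  ∏ e ∈ G.componentEdges c, Y (σ e.1, τ e.2)

/-- The product over the connected components of the monomials, each centred under the mixture
law. -/
def labelledPoly (G : BiGraph) {n d : ℕ} (Kn Kd : ℕ) (lam : ℝ)
    (σ : Fin (G.r + 1) ↪ Fin n) (τ : Fin G.s ↪ Fin d) (Y : Fin n × Fin d → ℝ) : ℝ :=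
  ∏ c ∈ G.components, (G.componentMonomial c σ τ Y -
    ∫ Z, G.componentMonomial c σ τ Z ∂(mixtureLaw n d Kn Kd lam))

/-- The sum of the labelled polynomials over all pairs of injective labellings such that `v₁` is
sent to the first row. -/
def templatePoly (G : BiGraph) {n d : ℕ} [NeZero n] (Kn Kd : ℕ) (lam : ℝ)
    (Y : Fin n × Fin d → ℝ) : ℝ :=
  ∑ σ : Fin (G.r + 1) ↪ Fin n with σ 0 = 0, ∑ τ : Fin G.s ↪ Fin d,
    G.labelledPoly Kn Kd lam σ τ Y

/-- The normalisation `(n-1)! / (n-|V|)! * d! / (d-|W|)! * |Aut*(G)|`. -/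
def normalization (G : BiGraph) (n d : ℕ) : ℝ :=
  ((n - 1).factorial : ℝ) / ((n - (G.r + 1)).factorial : ℝ) *
    ((d.factorial : ℝ) / ((d - G.s).factorial : ℝ)) * (G.autCard : ℝ)

/-- The normalised, centred template polynomial `Ψ*_G`. -/
def Psi (G : BiGraph) {n d : ℕ} [NeZero n] (Kn Kd : ℕ) (lam : ℝ)
    (Y : Fin n × Fin d → ℝ) : ℝ :=
  G.templatePoly Kn Kd lam Y / Real.sqrt (G.normalization n d)

end BiGraph

end SubmatrixLD

end

noncomputable section

set_option linter.unusedSectionVars false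

namespace SubmatrixLD

/-! ### Components of an edge set -/

section EdgeSets

variable {ι κ : Type*} [DecidableEq ι] [DecidableEq κ]

/-! A labelled template polynomial depends only on the edge set A of its copy in the complete
bipartite graph: it is Q_A = `centredPoly` at A. The combination thus becomes a sum of x_A Q_A over
edge sets with at most D edges. Inequivalent templates have no copy in common and each copy comes
from |Aut*| labellings, so the normalisation makes the sum of the x_A² exactly α₀² + Σ α_G²
(`sum_edgeCoeff_sq`). It remains to show that the Gram matrix of the Q_A is close to the identity in
operator norm, for arbitrary x (`abs_integral_sq_sub_le`).

Let p = Kn/n, q = Kd/d and ε = D^(-8cs). Entries are signs, so a product of two monomials is almost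
surely the monomial of the symmetric difference. The Gram entry at (A, B) vanishes if a component of
one edge set shares no vertex with the other, by independence and centring. Otherwise it is at most
16^|A∆B| times the moment of A∆B, and the vertices met by exactly one of A, B number at most |A∆B|
(`card_gained_add_lost_le`). Paying λp ≤ ε/√n for each such row, λq ≤ ε/√d for each such column and
λ ≤ ε for each left-over edge gives (16ε)^|A∆B| n^(-a/2) d^(-b/2), with a such rows and b such
columns.

A Schur test with weights n^(-|rows|/2) d^(-|cols|/2) turns these half powers into a full 1/n or 1/d
for each vertex of B that is new to A, which pays for the choice of that vertex. Old vertices leave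
O(D) choices, so off-diagonal row sums are O(D²ε). The diagonal differs from 1 by at most Dλ. -/

/-- Two edges touch if they share an endpoint. -/
def Touch (e f : ι × κ) : Prop := e.1 = f.1 ∨ e.2 = f.2

lemma Touch.symm {e f : ι × κ} (h : Touch e f) : Touch f e :=
  h.imp Eq.symm Eq.symm

lemma Touch.refl (e : ι × κ) : Touch e e := Or.inl rfl

/-- `U` is stable under passing to touching edges of `A`. -/
def ClosedIn (A : Finset (ι × κ)) (U : Set (ι × κ)) : Prop :=
  ∀ x ∈ U, ∀ y ∈ A, Touch x y → y ∈ U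

open Classical in
/-- The edges of the connected component of `A` that contains `e`. -/
def edgeClass (A : Finset (ι × κ)) (e : ι × κ) : Finset (ι × κ) :=
  -- Connectedness as membership in every closed set avoids paths and transports easily along
  -- injections.
  A.filter fun f => ∀ U : Set (ι × κ), ClosedIn A U → e ∈ U → f ∈ U

/-- The edge sets of the connected components of `A`. -/
def comps (A : Finset (ι × κ)) : Finset (Finset (ι × κ)) :=
  A.image (edgeClass A)

/-- The rows met by `A`. -/
def rows (A : Finset (ι × κ)) : Finset ι := A.image Prod.fst

/-- The columns met by `A`. -/
def cols (A : Finset (ι × κ)) : Finset κ := A.image Prod.snd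

lemma mem_rows {A : Finset (ι × κ)} {i : ι} : i ∈ rows A ↔ ∃ k, (i, k) ∈ A := by
  simp [rows]

lemma mem_cols {A : Finset (ι × κ)} {k : κ} : k ∈ cols A ↔ ∃ i, (i, k) ∈ A := by
  simp [cols]

lemma fst_mem_rows {A : Finset (ι × κ)} {e : ι × κ} (h : e ∈ A) : e.1 ∈ rows A :=
  Finset.mem_image_of_mem _ h

lemma snd_mem_cols {A : Finset (ι × κ)} {e : ι × κ} (h : e ∈ A) : e.2 ∈ cols A :=
  Finset.mem_image_of_mem _ h

lemma rows_mono {A B : Finset (ι × κ)} (h : A ⊆ B) : rows A ⊆ rows B :=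
  Finset.image_subset_image h

lemma cols_mono {A B : Finset (ι × κ)} (h : A ⊆ B) : cols A ⊆ cols B :=
  Finset.image_subset_image h

lemma rows_union (A B : Finset (ι × κ)) : rows (A ∪ B) = rows A ∪ rows B :=
  Finset.image_union _ _

lemma cols_union (A B : Finset (ι × κ)) : cols (A ∪ B) = cols A ∪ cols B :=
  Finset.image_union _ _

lemma card_rows_le (A : Finset (ι × κ)) : (rows A).card ≤ A.card := Finset.card_image_le

lemma card_cols_le (A : Finset (ι × κ)) : (cols A).card ≤ A.card := Finset.card_image_le

/-- No row and no column meets both `A` and `B`. -/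
def VDisj (A B : Finset (ι × κ)) : Prop :=
  Disjoint (rows A) (rows B) ∧ Disjoint (cols A) (cols B)

lemma vDisj_iff {A B : Finset (ι × κ)} :
    VDisj A B ↔ ∀ e ∈ A, ∀ f ∈ B, ¬ Touch e f := by
  constructor
  · rintro ⟨h1, h2⟩ e he f hf (h | h)
    · exact Finset.disjoint_left.1 h1 (fst_mem_rows he) (h ▸ fst_mem_rows hf)
    · exact Finset.disjoint_left.1 h2 (snd_mem_cols he) (h ▸ snd_mem_cols hf)
  · intro h
    constructor
    · refine Finset.disjoint_left.2 fun i hi hj => ?_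
      obtain ⟨k, hk⟩ := mem_rows.1 hi
      obtain ⟨l, hl⟩ := mem_rows.1 hj
      exact h _ hk _ hl (Or.inl rfl)
    · refine Finset.disjoint_left.2 fun i hi hj => ?_
      obtain ⟨k, hk⟩ := mem_cols.1 hi
      obtain ⟨l, hl⟩ := mem_cols.1 hj
      exact h _ hk _ hl (Or.inr rfl)

lemma VDisj.disjoint {A B : Finset (ι × κ)} (h : VDisj A B) : Disjoint A B :=
  Finset.disjoint_left.2 fun e he hf => vDisj_iff.1 h e he e hf (Touch.refl e)

lemma edgeClass_subset (A : Finset (ι × κ)) (e : ι × κ) : edgeClass A e ⊆ A := by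
  classical exact Finset.filter_subset _ _

lemma mem_edgeClass {A : Finset (ι × κ)} {e f : ι × κ} :
    f ∈ edgeClass A e ↔ f ∈ A ∧ ∀ U : Set (ι × κ), ClosedIn A U → e ∈ U → f ∈ U := by
  simp [edgeClass]

lemma mem_edgeClass_self {A : Finset (ι × κ)} {e : ι × κ} (he : e ∈ A) : e ∈ edgeClass A e :=
  mem_edgeClass.2 ⟨he, fun _ _ h => h⟩

lemma closedIn_edgeClass (A : Finset (ι × κ)) (e : ι × κ) : ClosedIn A (edgeClass A e) := by
  intro x hx y hy hxy
  have hx' := mem_edgeClass.1 (Finset.mem_coe.1 hx)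
  exact Finset.mem_coe.2 (mem_edgeClass.2 ⟨hy, fun U hU he => hU x (hx'.2 U hU he) y hy hxy⟩)

lemma mem_edgeClass_symm {A : Finset (ι × κ)} {e f : ι × κ} (he : e ∈ A)
    (h : f ∈ edgeClass A e) : e ∈ edgeClass A f := by
  refine mem_edgeClass.2 ⟨he, fun U hU hf => ?_⟩
  by_contra heU
  -- Touching is symmetric, so the complement in `A` of a closed set is closed; it would separate
  -- `e` from `f`.
  have hc : ClosedIn A {x | x ∈ A ∧ x ∉ U} := fun x hx y hy hxy =>
    ⟨hy, fun hyU => hx.2 (hU y hyU x hx.1 hxy.symm)⟩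
  exact ((mem_edgeClass.1 h).2 _ hc ⟨he, heU⟩).2 hf

lemma edgeClass_eq_of_mem {A : Finset (ι × κ)} {e f : ι × κ} (he : e ∈ A)
    (h : f ∈ edgeClass A e) : edgeClass A f = edgeClass A e := by
  apply Finset.Subset.antisymm
  · intro x hx
    exact (mem_edgeClass.1 hx).2 _ (closedIn_edgeClass A e) h
  · intro x hx
    exact (mem_edgeClass.1 hx).2 _ (closedIn_edgeClass A f) (mem_edgeClass_symm he h)

lemma mem_comps {A C : Finset (ι × κ)} : C ∈ comps A ↔ ∃ e ∈ A, edgeClass A e = C := by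
  simp [comps]

lemma edgeClass_mem_comps {A : Finset (ι × κ)} {e : ι × κ} (he : e ∈ A) :
    edgeClass A e ∈ comps A := Finset.mem_image_of_mem _ he

lemma subset_of_mem_comps {A C : Finset (ι × κ)} (hC : C ∈ comps A) : C ⊆ A := by
  obtain ⟨e, _, rfl⟩ := mem_comps.1 hC
  exact edgeClass_subset A e

lemma nonempty_of_mem_comps {A C : Finset (ι × κ)} (hC : C ∈ comps A) : C.Nonempty := by
  obtain ⟨e, he, rfl⟩ := mem_comps.1 hC
  exact ⟨e, mem_edgeClass_self he⟩

lemma closedIn_of_mem_comps {A C : Finset (ι × κ)} (hC : C ∈ comps A) : ClosedIn A C := by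
  obtain ⟨e, _, rfl⟩ := mem_comps.1 hC
  exact closedIn_edgeClass A e

lemma eq_edgeClass_of_mem {A C : Finset (ι × κ)} (hC : C ∈ comps A) {e : ι × κ} (he : e ∈ C) :
    edgeClass A e = C := by
  obtain ⟨f, hf, rfl⟩ := mem_comps.1 hC
  exact edgeClass_eq_of_mem hf he

lemma subset_of_closedIn {A C : Finset (ι × κ)} (hC : C ∈ comps A) {U : Set (ι × κ)}
    (hU : ClosedIn A U) {e : ι × κ} (he : e ∈ C) (heU : e ∈ U) : ∀ f ∈ C, f ∈ U := by
  intro f hf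
  rw [← eq_edgeClass_of_mem hC he] at hf
  exact (mem_edgeClass.1 hf).2 U hU heU

lemma eq_of_touch {A C C' : Finset (ι × κ)} (hC : C ∈ comps A) (hC' : C' ∈ comps A)
    {e f : ι × κ} (he : e ∈ C) (hf : f ∈ C') (h : Touch e f) : C = C' := by
  have h1 : f ∈ C := closedIn_of_mem_comps hC e he f (subset_of_mem_comps hC' hf) h
  rw [← eq_edgeClass_of_mem hC h1, eq_edgeClass_of_mem hC' hf]

lemma vDisj_of_ne {A C C' : Finset (ι × κ)} (hC : C ∈ comps A) (hC' : C' ∈ comps A)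
    (h : C ≠ C') : VDisj C C' :=
  vDisj_iff.2 fun _ he _ hf ht => h (eq_of_touch hC hC' he hf ht)

lemma biUnion_comps_subset {A : Finset (ι × κ)} {I : Finset (Finset (ι × κ))}
    (hI : I ⊆ comps A) : I.biUnion id ⊆ A :=
  Finset.biUnion_subset.2 fun _ hC => subset_of_mem_comps (hI hC)

lemma card_comps_le (A : Finset (ι × κ)) : (comps A).card ≤ A.card := Finset.card_image_le

/-- A component of `A` that is contained in `B` and touches no edge of `B \ A` is a component
of `B`. -/
lemma mem_comps_of_subset {A B C : Finset (ι × κ)} (hC : C ∈ comps A) (hCB : C ⊆ B)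
    (h : ∀ e ∈ B, e ∉ A → ∀ f ∈ C, ¬ Touch f e) : C ∈ comps B := by
  obtain ⟨e, he⟩ := nonempty_of_mem_comps hC
  have hclosed : ClosedIn B (C : Set (ι × κ)) := fun x hx y hy hxy => by
    by_cases hyA : y ∈ A
    · exact closedIn_of_mem_comps hC x hx y hyA hxy
    · exact absurd hxy (h y hy hyA x hx)
  refine mem_comps.2 ⟨e, hCB he, Finset.Subset.antisymm ?_ ?_⟩
  · intro x hx
    exact (mem_edgeClass.1 hx).2 _ hclosed he
  · intro x hx
    refine mem_edgeClass.2 ⟨hCB hx, fun U hU heU => ?_⟩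
    have hU' : ClosedIn A (U ∩ C) := fun y hy z hz hyz =>
      have hzC := closedIn_of_mem_comps hC y hy.2 z hz hyz
      ⟨hU y hy.1 z (hCB hzC) hyz, hzC⟩
    exact (subset_of_closedIn hC hU' he ⟨heU, he⟩ x hx).1

/-- Components of `A` that are not components of `B` touch an edge of the symmetric difference. -/
lemma exists_touch_of_notMem_comps {A B C : Finset (ι × κ)} (hC : C ∈ comps A)
    (hCB : C ∉ comps B) : ∃ e ∈ symmDiff A B, ∃ f ∈ C, Touch f e := by
  by_cases hsub : C ⊆ B
  · by_contra! hcon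
    refine hCB (mem_comps_of_subset hC hsub fun e heB heA f hf => ?_)
    exact hcon e (Finset.mem_symmDiff.2 (Or.inr ⟨heB, heA⟩)) f hf
  · obtain ⟨e, heC, heB⟩ := Finset.not_subset.1 hsub
    exact ⟨e, Finset.mem_symmDiff.2 (Or.inl ⟨subset_of_mem_comps hC heC, heB⟩), e, heC,
      Touch.refl e⟩

/-- An unmatched component meets the row or the column of some edge of the symmetric difference, and
a given row or column belongs to at most one component. -/
lemma card_comps_sdiff_le (A B : Finset (ι × κ)) :
    (comps A \ comps B).card ≤ 2 * (symmDiff A B).card := by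
  classical
  have hsub : comps A \ comps B ⊆ (symmDiff A B).biUnion fun e =>
      ((comps A).filter fun C => e.1 ∈ rows C) ∪ ((comps A).filter fun C => e.2 ∈ cols C) := by
    intro C hC
    obtain ⟨hCA, hCB⟩ := Finset.mem_sdiff.1 hC
    obtain ⟨e, he, f, hf, ht⟩ := exists_touch_of_notMem_comps hCA hCB
    refine Finset.mem_biUnion.2 ⟨e, he, ?_⟩
    rcases ht with h | h
    · exact Finset.mem_union_left _ (Finset.mem_filter.2 ⟨hCA, h ▸ fst_mem_rows hf⟩)
    · exact Finset.mem_union_right _ (Finset.mem_filter.2 ⟨hCA, h ▸ snd_mem_cols hf⟩)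
  refine (Finset.card_le_card hsub).trans ((Finset.card_biUnion_le_card_mul _ _ 2 ?_).trans
    (mul_comm _ _).le)
  intro e _
  refine (Finset.card_union_le _ _).trans ?_
  have h1 : ((comps A).filter fun C => e.1 ∈ rows C).card ≤ 1 := by
    refine Finset.card_le_one.2 fun C hC C' hC' => ?_
    simp only [Finset.mem_filter, mem_rows] at hC hC'
    obtain ⟨hC, k, hk⟩ := hC
    obtain ⟨hC', l, hl⟩ := hC'
    exact eq_of_touch hC hC' hk hl (Or.inl rfl)
  have h2 : ((comps A).filter fun C => e.2 ∈ cols C).card ≤ 1 := by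
    refine Finset.card_le_one.2 fun C hC C' hC' => ?_
    simp only [Finset.mem_filter, mem_cols] at hC hC'
    obtain ⟨hC, k, hk⟩ := hC
    obtain ⟨hC', l, hl⟩ := hC'
    exact eq_of_touch hC hC' hk hl (Or.inr rfl)
  omega

/-! ### Counting edges that leave a vertex set -/

/-- If every nonempty set of vertices inside `R ⊔ T` is left by an edge of `F`, then `F` has at
least as many edges as `R ⊔ T` has vertices. -/
lemma card_add_card_le_of_leaving (m : ℕ) : ∀ (F : Finset (ι × κ)) (R : Finset ι) (T : Finset κ),
    R.card + T.card = m →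
    (∀ R' ⊆ R, ∀ T' ⊆ T, (R'.Nonempty ∨ T'.Nonempty) →
      ∃ e ∈ F, (e.1 ∈ R' ∧ e.2 ∉ T') ∨ (e.1 ∉ R' ∧ e.2 ∈ T')) →
    R.card + T.card ≤ F.card := by
  induction m with
  | zero => intro F R T h _; omega
  | succ m ih =>
    intro F R T hm h
    have hne : R.Nonempty ∨ T.Nonempty := by
      by_contra! hcon
      simp [hcon.1, hcon.2] at hm
    obtain ⟨e, heF, he | he⟩ := h R subset_rfl T subset_rfl hne
    · have hc := Finset.card_erase_add_one he.1
      -- Once `e.1` is removed, `e` has no endpoint in the remaining vertices, so the edge leaving a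
      -- smaller set is never `e`.
      have key := ih (F.erase e) (R.erase e.1) T (by omega) (fun R' hR' T' hT' hn => by
        obtain ⟨f, hf, hf'⟩ := h R' (hR'.trans (Finset.erase_subset _ _)) T' hT' hn
        refine ⟨f, Finset.mem_erase.2 ⟨?_, hf⟩, hf'⟩
        rintro rfl
        rcases hf' with h' | h'
        · exact Finset.notMem_erase _ _ (hR' h'.1)
        · exact he.2 (hT' h'.2))
      have hF := Finset.card_erase_add_one heF
      omega
    · have hc := Finset.card_erase_add_one he.2
      have key := ih (F.erase e) R (T.erase e.2) (by omega) (fun R' hR' T' hT' hn => by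
        obtain ⟨f, hf, hf'⟩ := h R' hR' T' (hT'.trans (Finset.erase_subset _ _)) hn
        refine ⟨f, Finset.mem_erase.2 ⟨?_, hf⟩, hf'⟩
        rintro rfl
        rcases hf' with h' | h'
        · exact he.1 (hR' h'.1)
        · exact Finset.notMem_erase _ _ (hT' h'.2))
      have hF := Finset.card_erase_add_one heF
      omega

/-- If no component of `B` avoids the vertices of `A`, no nonempty set of vertices of `B` outside
`A` is closed under the edges of `B`. -/
lemma exists_leaving_edge {A B : Finset (ι × κ)} (hB : ∀ C ∈ comps B, ¬ VDisj C A)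
    {R : Finset ι} {T : Finset κ} (hR : ∀ i ∈ R, i ∉ rows A) (hT : ∀ k ∈ T, k ∉ cols A)
    {e : ι × κ} (he : e ∈ B) (heRT : e.1 ∈ R ∨ e.2 ∈ T) :
    ∃ f ∈ B, (f.1 ∈ R ∧ f.2 ∉ T) ∨ (f.1 ∉ R ∧ f.2 ∈ T) := by
  by_contra! hcon
  refine hB _ (edgeClass_mem_comps he) ?_
  have hboth : ∀ f ∈ B, (f.1 ∈ R ∨ f.2 ∈ T) → f.1 ∈ R ∧ f.2 ∈ T := fun f hf h => by
    have := hcon f hf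
    tauto
  have hcl : ClosedIn B {f | f.1 ∈ R ∧ f.2 ∈ T} := by
    rintro x ⟨hx1, hx2⟩ y hy (h | h)
    · exact hboth y hy (Or.inl (h ▸ hx1))
    · exact hboth y hy (Or.inr (h ▸ hx2))
  refine vDisj_iff.2 fun f hf g hg ht => ?_
  obtain ⟨h1, h2⟩ := (mem_edgeClass.1 hf).2 _ hcl (hboth e he heRT)
  rcases ht with h | h
  · exact hR _ h1 (h ▸ fst_mem_rows hg)
  · exact hT _ h2 (h ▸ snd_mem_cols hg)

/-- The combinatorial core: a set of gained vertices left by no edge of A∆B would contain a whole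
component of `B` avoiding `A`, and symmetrically for lost vertices. Hence
`card_add_card_le_of_leaving` applies. -/
lemma card_gained_add_lost_le {A B : Finset (ι × κ)} (hA : ∀ C ∈ comps A, ¬ VDisj C B)
    (hB : ∀ C ∈ comps B, ¬ VDisj C A) :
    (symmDiff (rows A) (rows B)).card + (symmDiff (cols A) (cols B)).card ≤
      (symmDiff A B).card := by
  refine card_add_card_le_of_leaving _ _ _ _ rfl fun R hR T hT hne => ?_
  -- a closed set of gained vertices is impossible, and likewise for lost vertices
  have key : ∀ {A B : Finset (ι × κ)}, (∀ C ∈ comps B, ¬ VDisj C A) →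
      R ⊆ symmDiff (rows A) (rows B) → T ⊆ symmDiff (cols A) (cols B) →
      ((R \ rows A).Nonempty ∨ (T \ cols A).Nonempty) →
      ∃ e ∈ symmDiff A B, (e.1 ∈ R ∧ e.2 ∉ T) ∨ (e.1 ∉ R ∧ e.2 ∈ T) := by
    intro A B hB hR hT hne
    have hex : ∃ e ∈ B, e.1 ∈ R \ rows A ∨ e.2 ∈ T \ cols A := by
      rcases hne with ⟨i, hi⟩ | ⟨k, hk⟩
      · obtain ⟨hi1, hi2⟩ := Finset.mem_sdiff.1 hi
        have := hR hi1
        simp only [Finset.mem_symmDiff, hi2, false_and, false_or, not_false_eq_true,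
          and_true] at this
        obtain ⟨k, hk⟩ := mem_rows.1 this
        exact ⟨_, hk, Or.inl hi⟩
      · obtain ⟨hi1, hi2⟩ := Finset.mem_sdiff.1 hk
        have := hT hi1
        simp only [Finset.mem_symmDiff, hi2, false_and, false_or, not_false_eq_true,
          and_true] at this
        obtain ⟨i, hi⟩ := mem_cols.1 this
        exact ⟨_, hi, Or.inr hk⟩
    obtain ⟨e, heB, he⟩ := hex
    obtain ⟨f, hf, hf'⟩ := exists_leaving_edge hB (R := R \ rows A) (T := T \ cols A)
      (fun i hi => (Finset.mem_sdiff.1 hi).2) (fun i hi => (Finset.mem_sdiff.1 hi).2) heB he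
    have hr := fst_mem_rows hf
    have hc := snd_mem_cols hf
    -- Since `f ∈ B`, an endpoint of `f` in the symmetric difference is a gained one. Leaving the
    -- gained part of `R ⊔ T` therefore means leaving `R ⊔ T` itself.
    have hR1 : f.1 ∈ R → f.1 ∉ rows A := fun h =>
      (Finset.mem_symmDiff.1 (hR h)).elim (fun h' => absurd hr h'.2) fun h' => h'.2
    have hT1 : f.2 ∈ T → f.2 ∉ cols A := fun h =>
      (Finset.mem_symmDiff.1 (hT h)).elim (fun h' => absurd hc h'.2) fun h' => h'.2
    simp only [Finset.mem_sdiff] at hf'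
    refine ⟨f, Finset.mem_symmDiff.2 (Or.inr ⟨hf, fun hfA => ?_⟩), ?_⟩
    · rcases hf' with h' | h'
      · exact h'.1.2 (fst_mem_rows hfA)
      · exact h'.2.2 (snd_mem_cols hfA)
    · rcases hf' with h' | h'
      · exact Or.inl ⟨h'.1.1, fun h => h'.2 ⟨h, hT1 h⟩⟩
      · exact Or.inr ⟨fun h => h'.1 ⟨h, hR1 h⟩, h'.2.1⟩
  by_cases hcase : (R \ rows A).Nonempty ∨ (T \ cols A).Nonempty
  · exact key hB hR hT hcase
  · rw [symmDiff_comm A B]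
    rw [symmDiff_comm (rows A)] at hR
    rw [symmDiff_comm (cols A)] at hT
    refine key hA hR hT ?_
    push Not at hcase
    rw [Finset.sdiff_eq_empty_iff_subset, Finset.sdiff_eq_empty_iff_subset] at hcase
    rcases hne with ⟨i, hi⟩ | ⟨k, hk⟩
    · exact Or.inl ⟨i, Finset.mem_sdiff.2 ⟨hi, fun h =>
        (Finset.mem_symmDiff.1 (hR hi)).elim (fun h' => h'.2 (hcase.1 hi)) fun h' => h'.2 h⟩⟩
    · exact Or.inr ⟨k, Finset.mem_sdiff.2 ⟨hk, fun h =>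
        (Finset.mem_symmDiff.1 (hT hk)).elim (fun h' => h'.2 (hcase.2 hk)) fun h' => h'.2 h⟩⟩

end EdgeSets

/-! ### Moments of the observation -/

section Moments

lemma isProbabilityMeasure_signLaw {m : ℝ} (h0 : -1 ≤ m) (h1 : m ≤ 1) :
    IsProbabilityMeasure (signLaw m) := by
  constructor
  simp only [signLaw, Measure.coe_add, Measure.coe_smul, Pi.add_apply, Pi.smul_apply,
    measure_univ, smul_eq_mul, mul_one]
  rw [← ENNReal.ofReal_add (by linarith) (by linarith)]
  norm_num [← add_div]

lemma integrable_signLaw (m : ℝ) (f : ℝ → ℝ) : Integrable f (signLaw m) := by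
  unfold signLaw
  refine Integrable.add_measure ?_ ?_
  · exact (integrable_dirac (by simp)).smul_measure ENNReal.ofReal_ne_top
  · exact (integrable_dirac (by simp)).smul_measure ENNReal.ofReal_ne_top

lemma integral_id_signLaw {m : ℝ} (h0 : -1 ≤ m) (h1 : m ≤ 1) : ∫ x, x ∂(signLaw m) = m := by
  have h := integrable_signLaw m id
  unfold signLaw at h ⊢
  have h' := integrable_add_measure.1 h
  rw [integral_add_measure (f := fun x => x) h'.1 h'.2, integral_smul_measure,
    integral_smul_measure, integral_dirac, integral_dirac,
    ENNReal.toReal_ofReal (by linarith), ENNReal.toReal_ofReal (by linarith)]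
  simp only [smul_eq_mul]
  ring

lemma ae_signLaw (m : ℝ) : ∀ᵐ x ∂(signLaw m), x * x = 1 := by
  unfold signLaw
  rw [ae_add_measure_iff]
  constructor
  · exact Measure.ae_smul_measure (by simp [ae_dirac_eq]) _
  · exact Measure.ae_smul_measure (by simp [ae_dirac_eq]) _

variable {n d : ℕ}

/-- The monomial `∏ Y_e` over the edges of `F`. -/
def mono (F : Finset (Fin n × Fin d)) (Y : Fin n × Fin d → ℝ) : ℝ := ∏ e ∈ F, Y e

lemma mono_eq_prod_ite (F : Finset (Fin n × Fin d)) :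
    mono F = fun Y => ∏ e, (fun x : ℝ => if e ∈ F then x else 1) (Y e) := by
  ext Y
  simp [mono, Finset.prod_ite_mem]

/-! ### Independent signs with prescribed means. -/

section Cond

variable {M : Fin n × Fin d → ℝ} (hM : ∀ e, -1 ≤ M e ∧ M e ≤ 1)
include hM

lemma ae_condLaw : ∀ᵐ Y ∂(condLaw M), ∀ e, Y e * Y e = 1 := by
  have : ∀ e, IsProbabilityMeasure (signLaw (M e)) := fun e =>
    isProbabilityMeasure_signLaw (hM e).1 (hM e).2
  rw [ae_all_iff]
  intro e
  exact (Measure.tendsto_eval_ae_ae (μ := fun e => signLaw (M e)) (i := e)).eventually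
    (ae_signLaw (M e))

lemma integrable_mono_condLaw (F : Finset (Fin n × Fin d)) :
    Integrable (mono F) (condLaw M) := by
  have : ∀ e, IsProbabilityMeasure (signLaw (M e)) := fun e =>
    isProbabilityMeasure_signLaw (hM e).1 (hM e).2
  rw [mono_eq_prod_ite]
  exact Integrable.fintype_prod_dep
    (f := fun e => (fun x : ℝ => if e ∈ F then x else 1)) fun e => integrable_signLaw _ _

lemma integral_mono_condLaw (F : Finset (Fin n × Fin d)) :
    ∫ Y, mono F Y ∂(condLaw M) = ∏ e ∈ F, M e := by
  have : ∀ e, IsProbabilityMeasure (signLaw (M e)) := fun e =>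
    isProbabilityMeasure_signLaw (hM e).1 (hM e).2
  rw [mono_eq_prod_ite]
  unfold condLaw
  rw [integral_fintype_prod_eq_prod (𝕜 := ℝ)
    (fun e => (fun x : ℝ => if e ∈ F then x else 1)), ← Finset.prod_subset (Finset.subset_univ F)]
  · refine Finset.prod_congr rfl fun e he => ?_
    simp only [he, if_true]
    exact integral_id_signLaw (hM e).1 (hM e).2
  · intro e _ he
    simp [he]

end Cond

/-- Expand ∏ᵢ (p + (1-p)·1{i ∉ R}) over subsets `S`: a term with `R ⊄ S` contains a zero factor. -/
lemma sum_bernoulliWeight_superset {m : ℕ} (p : ℝ) (R : Finset (Fin m)) :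
    ∑ S : Finset (Fin m), bernoulliWeight p S * (if R ⊆ S then 1 else 0) = p ^ R.card := by
  have h := Fintype.prod_add (fun _ : Fin m => p) (fun i => if i ∈ R then 0 else 1 - p)
  have h1 : ∏ i : Fin m, (p + if i ∈ R then 0 else 1 - p) = p ^ R.card := by
    have : ∀ i : Fin m, (p + if i ∈ R then 0 else 1 - p) = if i ∈ R then p else 1 := by
      intro i
      split_ifs <;> ring
    simp only [this, Finset.prod_ite_mem, Finset.univ_inter, Finset.prod_const]
  rw [← h1, h]
  refine Finset.sum_congr rfl fun S _ => ?_
  have hw : bernoulliWeight p S = (∏ _i ∈ S, p) * ∏ _i ∈ Sᶜ, (1 - p) := by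
    unfold bernoulliWeight
    rw [← Finset.prod_mul_prod_compl S]
    congr 1
    · exact Finset.prod_congr rfl fun i hi => by simp [hi]
    · exact Finset.prod_congr rfl fun i hi => by simp [Finset.mem_compl.1 hi]
  by_cases hRS : R ⊆ S
  · rw [if_pos hRS, mul_one, hw]
    congr 1
    exact Finset.prod_congr rfl fun i hi => by
      rw [if_neg fun h => Finset.mem_compl.1 hi (hRS h)]
  · rw [if_neg hRS, mul_zero]
    obtain ⟨i, hiR, hiS⟩ := Finset.not_subset.1 hRS
    have h0 : ∏ i ∈ Sᶜ, (if i ∈ R then 0 else 1 - p) = 0 :=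
      Finset.prod_eq_zero (i := i) (by simpa using hiS) (by simp [hiR])
    rw [h0, mul_zero]

lemma bernoulliWeight_nonneg {m : ℕ} {p : ℝ} (h0 : 0 ≤ p) (h1 : p ≤ 1) (S : Finset (Fin m)) :
    0 ≤ bernoulliWeight p S := by
  refine Finset.prod_nonneg fun i _ => ?_
  split_ifs <;> linarith

/-- The moment `lam ^ |F| * p ^ |rows F| * q ^ |cols F|`. -/
def moment (p q lam : ℝ) (F : Finset (Fin n × Fin d)) : ℝ :=
  lam ^ F.card * p ^ (rows F).card * q ^ (cols F).card

lemma blockMatrix_bounds {lam : ℝ} (h0 : 0 ≤ lam) (h1 : lam ≤ 1) (S : Finset (Fin n))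
    (T : Finset (Fin d)) (e : Fin n × Fin d) :
    -1 ≤ blockMatrix lam S T e ∧ blockMatrix lam S T e ≤ 1 := by
  unfold blockMatrix
  split_ifs <;> constructor <;> linarith

lemma prod_blockMatrix (lam : ℝ) (S : Finset (Fin n)) (T : Finset (Fin d))
    (F : Finset (Fin n × Fin d)) :
    ∏ e ∈ F, blockMatrix lam S T e =
      lam ^ F.card * (if rows F ⊆ S then 1 else 0) * (if cols F ⊆ T then 1 else 0) := by
  by_cases hS : rows F ⊆ S
  · by_cases hT : cols F ⊆ T
    · rw [if_pos hS, if_pos hT, mul_one, mul_one, ← Finset.prod_const]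
      refine Finset.prod_congr rfl fun e he => ?_
      rw [blockMatrix, if_pos ⟨hS (fst_mem_rows he), hT (snd_mem_cols he)⟩]
    · rw [if_neg hT, mul_zero]
      obtain ⟨k, hk, hkT⟩ := Finset.not_subset.1 hT
      obtain ⟨i, hi⟩ := mem_cols.1 hk
      exact Finset.prod_eq_zero hi (by simp [blockMatrix, hkT])
  · rw [if_neg hS, mul_zero, zero_mul]
    obtain ⟨i, hi, hiS⟩ := Finset.not_subset.1 hS
    obtain ⟨k, hk⟩ := mem_rows.1 hi
    exact Finset.prod_eq_zero hk (by simp [blockMatrix, hiS])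

/-- Edges common to both monomials contribute squares of signs. -/
lemma mono_mul_ae (μ : Measure (Fin n × Fin d → ℝ)) (hμ : ∀ᵐ Y ∂μ, ∀ e, Y e * Y e = 1)
    (F G : Finset (Fin n × Fin d)) : mono F * mono G =ᵐ[μ] mono (symmDiff F G) := by
  filter_upwards [hμ] with Y hY
  have h1 : mono F Y = mono (F \ G) Y * mono (F ∩ G) Y := by
    simp only [mono]
    rw [← Finset.prod_union (Finset.disjoint_sdiff_inter F G), Finset.sdiff_union_inter]
  have h2 : mono G Y = mono (G \ F) Y * mono (F ∩ G) Y := by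
    simp only [mono]
    rw [Finset.inter_comm F G, ← Finset.prod_union (Finset.disjoint_sdiff_inter G F),
      Finset.sdiff_union_inter]
  have h3 : mono (symmDiff F G) Y = mono (F \ G) Y * mono (G \ F) Y := by
    rw [mono, symmDiff_def, Finset.sup_eq_union, Finset.prod_union disjoint_sdiff_sdiff]
    rfl
  have h4 : mono (F ∩ G) Y * mono (F ∩ G) Y = 1 := by
    rw [mono, ← Finset.prod_mul_distrib]
    exact Finset.prod_eq_one fun e _ => hY e
  rw [Pi.mul_apply, h1, h2, h3]
  linear_combination (mono (F \ G) Y * mono (G \ F) Y) * h4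

/-! ### Polynomials in a block of entries -/

/-- The polynomials in the entries indexed by `P`. -/
def polys (P : Set (Fin n × Fin d)) : Subalgebra ℝ ((Fin n × Fin d → ℝ) → ℝ) :=
  Algebra.adjoin ℝ {f | ∃ e ∈ P, f = fun Y => Y e}

lemma mono_mem_polys {P : Set (Fin n × Fin d)} {F : Finset (Fin n × Fin d)}
    (hF : ∀ e ∈ F, e ∈ P) : mono F ∈ polys P := by
  have : mono F = ∏ e ∈ F, fun Y : Fin n × Fin d → ℝ => Y e := by
    ext Y
    simp [mono]
  rw [this]
  exact Subalgebra.prod_mem _ fun e he => Algebra.subset_adjoin ⟨e, hF e he, rfl⟩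

/-- With this, integrability and factorisation of polynomials need checking only on square-free
monomials. -/
lemma exists_mono_of_mem_closure {P : Set (Fin n × Fin d)} (μ : Measure (Fin n × Fin d → ℝ))
    (hμ : ∀ᵐ Y ∂μ, ∀ e, Y e * Y e = 1) {f : (Fin n × Fin d → ℝ) → ℝ}
    (hf : f ∈ Submonoid.closure {f | ∃ e ∈ P, f = fun Y : Fin n × Fin d → ℝ => Y e}) :
    ∃ F : Finset (Fin n × Fin d), (∀ e ∈ F, e ∈ P) ∧ f =ᵐ[μ] mono F := by
  induction hf using Submonoid.closure_induction with
  | mem f hf =>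
    obtain ⟨e, he, rfl⟩ := hf
    exact ⟨{e}, by simpa using he, Filter.Eventually.of_forall fun Y => by simp [mono]⟩
  | one => exact ⟨∅, by simp, Filter.Eventually.of_forall fun Y => by simp [mono]⟩
  | mul f g _ _ hf hg =>
    obtain ⟨F, hF, hF'⟩ := hf
    obtain ⟨G, hG, hG'⟩ := hg
    refine ⟨symmDiff F G, fun e he => ?_, (hF'.mul hG').trans (mono_mul_ae μ hμ F G)⟩
    rcases Finset.mem_symmDiff.1 he with he | he
    · exact hF e he.1
    · exact hG e he.1

lemma mem_span_of_mem_polys {P : Set (Fin n × Fin d)} {f : (Fin n × Fin d → ℝ) → ℝ}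
    (hf : f ∈ polys P) : f ∈ Submodule.span ℝ (Submonoid.closure
      {f | ∃ e ∈ P, f = fun Y : Fin n × Fin d → ℝ => Y e} : Set ((Fin n × Fin d → ℝ) → ℝ)) := by
  rw [← Algebra.adjoin_eq_span]
  exact hf

/-- All three exponents are additive over vertex-disjoint sets; this is where independence enters.
-/
lemma moment_union {F G : Finset (Fin n × Fin d)} (p q lam : ℝ) (hFG : VDisj F G) :
    moment p q lam (F ∪ G) = moment p q lam F * moment p q lam G := by
  simp only [moment, rows_union, cols_union, Finset.card_union_of_disjoint hFG.disjoint,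
    Finset.card_union_of_disjoint hFG.1, Finset.card_union_of_disjoint hFG.2, pow_add]
  ring

/-! ### Moments and factorisation under the mixture law. -/

/-- The parameters of the model are admissible. -/
structure Admissible (n d Kn Kd : ℕ) (lam : ℝ) : Prop where
  row_le : Kn ≤ n
  col_le : Kd ≤ d
  nonneg : 0 ≤ lam
  le_one : lam ≤ 1

variable {Kn Kd : ℕ} {lam : ℝ}

lemma div_nonneg_le_one {K m : ℕ} (h : K ≤ m) : 0 ≤ (K : ℝ) / m ∧ (K : ℝ) / m ≤ 1 :=
  ⟨by positivity, div_le_one_of_le₀ (by exact_mod_cast h) (by positivity)⟩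

variable (h : Admissible n d Kn Kd lam)
include h

lemma ae_mixtureLaw : ∀ᵐ Y ∂(mixtureLaw n d Kn Kd lam), ∀ e, Y e * Y e = 1 := by
  unfold mixtureLaw
  rw [ae_iff]
  simp only [Measure.finsetSum_apply]
  exact Finset.sum_eq_zero fun S _ => Finset.sum_eq_zero fun T _ => ae_iff.1
    (Measure.ae_smul_measure (ae_condLaw (blockMatrix_bounds h.nonneg h.le_one S T)) _)

lemma integrable_mono (F : Finset (Fin n × Fin d)) :
    Integrable (mono F) (mixtureLaw n d Kn Kd lam) := by
  unfold mixtureLaw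
  simp only [integrable_finsetSum_measure]
  exact fun S _ T _ => (integrable_mono_condLaw
    (blockMatrix_bounds h.nonneg h.le_one S T) F).smul_measure ENNReal.ofReal_ne_top

lemma integral_mono (F : Finset (Fin n × Fin d)) :
    ∫ Y, mono F Y ∂(mixtureLaw n d Kn Kd lam) = moment ((Kn : ℝ) / n) ((Kd : ℝ) / d) lam F := by
  have hp := div_nonneg_le_one h.row_le
  have hq := div_nonneg_le_one h.col_le
  have hI : ∀ S T, Integrable (mono F) (ENNReal.ofReal (bernoulliWeight ((Kn : ℝ) / n) S *
      bernoulliWeight ((Kd : ℝ) / d) T) • condLaw (blockMatrix lam S T)) := fun S T =>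
    (integrable_mono_condLaw
      (blockMatrix_bounds h.nonneg h.le_one S T) F).smul_measure ENNReal.ofReal_ne_top
  unfold mixtureLaw
  rw [integral_finsetSum_measure fun S _ => integrable_finsetSum_measure.2 fun T _ => hI S T]
  simp_rw [integral_finsetSum_measure fun T _ => hI _ T, integral_smul_measure,
    fun S T => integral_mono_condLaw (blockMatrix_bounds h.nonneg h.le_one S T) F,
    prod_blockMatrix, smul_eq_mul]
  rw [moment, ← sum_bernoulliWeight_superset ((Kn : ℝ) / n) (rows F),
    ← sum_bernoulliWeight_superset ((Kd : ℝ) / d) (cols F), mul_assoc, Finset.sum_mul_sum,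
    Finset.mul_sum]
  refine Finset.sum_congr rfl fun S _ => ?_
  rw [Finset.mul_sum]
  refine Finset.sum_congr rfl fun T _ => ?_
  rw [ENNReal.toReal_ofReal (mul_nonneg (bernoulliWeight_nonneg hp.1 hp.2 S)
    (bernoulliWeight_nonneg hq.1 hq.2 T))]
  ring

lemma integrable_of_mem_polys {P : Set (Fin n × Fin d)} {f : (Fin n × Fin d → ℝ) → ℝ}
    (hf : f ∈ polys P) : Integrable f (mixtureLaw n d Kn Kd lam) := by
  refine Submodule.span_induction (p := fun f _ => Integrable f (mixtureLaw n d Kn Kd lam))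
    ?_ ?_ ?_ ?_ (mem_span_of_mem_polys hf)
  · intro f hf
    obtain ⟨F, _, hF⟩ := exists_mono_of_mem_closure _ (ae_mixtureLaw h) hf
    exact (integrable_congr hF).2 (integrable_mono h F)
  · exact integrable_zero _ _ _
  · exact fun f g _ _ hf hg => hf.add hg
  · exact fun a f _ hf => hf.smul a

/-- Polynomials in blocks without common rows and columns are uncorrelated. -/
lemma integral_mul_of_mem_polys {P R : Set (Fin n × Fin d)}
    (hPR : ∀ e ∈ P, ∀ f ∈ R, ¬ Touch e f) {f g : (Fin n × Fin d → ℝ) → ℝ}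
    (hf : f ∈ polys P) (hg : g ∈ polys R) :
    ∫ Y, f Y * g Y ∂(mixtureLaw n d Kn Kd lam) =
      (∫ Y, f Y ∂(mixtureLaw n d Kn Kd lam)) * ∫ Y, g Y ∂(mixtureLaw n d Kn Kd lam) := by
  set μ := mixtureLaw n d Kn Kd lam with hμ
  -- A product of polynomials from different blocks needs one common algebra to be integrable.
  have hfull : ∀ {Q : Set (Fin n × Fin d)} {f : (Fin n × Fin d → ℝ) → ℝ},
      f ∈ Submodule.span ℝ (Submonoid.closure
        {f | ∃ e ∈ Q, f = fun Y : Fin n × Fin d → ℝ => Y e} :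
          Set ((Fin n × Fin d → ℝ) → ℝ)) → f ∈ polys (Set.univ : Set (Fin n × Fin d)) := by
    intro Q f hf
    rw [← Algebra.adjoin_eq_span] at hf
    refine Algebra.adjoin_mono ?_ hf
    rintro _ ⟨e, _, rfl⟩
    exact ⟨e, Set.mem_univ e, rfl⟩
  refine Submodule.span_induction₂ (p := fun f g _ _ =>
    ∫ Y, f Y * g Y ∂μ = (∫ Y, f Y ∂μ) * ∫ Y, g Y ∂μ) ?_ ?_ ?_ ?_ ?_ ?_ ?_
    (mem_span_of_mem_polys hf) (mem_span_of_mem_polys hg)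
  · intro f g hf hg
    obtain ⟨F, hFP, hF⟩ := exists_mono_of_mem_closure _ (ae_mixtureLaw h) hf
    obtain ⟨G, hGR, hG⟩ := exists_mono_of_mem_closure _ (ae_mixtureLaw h) hg
    have hV : VDisj F G := vDisj_iff.2 fun e he f hf => hPR e (hFP e he) f (hGR f hf)
    have hprod : ∫ Y, f Y * g Y ∂μ = ∫ Y, mono (symmDiff F G) Y ∂μ :=
      integral_congr_ae ((hF.mul hG).trans (mono_mul_ae _ (ae_mixtureLaw h) F G))
    rw [integral_congr_ae hF, integral_congr_ae hG, hprod, integral_mono h, integral_mono h,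
      integral_mono h, ← moment_union _ _ _ hV, hV.disjoint.symmDiff_eq_sup]
    rfl
  · intro g hg
    simp
  · intro f hf
    simp
  · intro f g k hf hg hk e1 e2
    have i1 := integrable_of_mem_polys h (mul_mem (hfull hf) (hfull hk))
    have i2 := integrable_of_mem_polys h (mul_mem (hfull hg) (hfull hk))
    have i3 := integrable_of_mem_polys h (hfull hf)
    have i4 := integrable_of_mem_polys h (hfull hg)
    simp only [Pi.add_apply, add_mul]
    rw [integral_add i3 i4, add_mul, ← e1, ← e2]
    exact integral_add i1 i2
  · intro f g k hf hg hk e1 e2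
    have i1 := integrable_of_mem_polys h (mul_mem (hfull hf) (hfull hg))
    have i2 := integrable_of_mem_polys h (mul_mem (hfull hf) (hfull hk))
    have i3 := integrable_of_mem_polys h (hfull hg)
    have i4 := integrable_of_mem_polys h (hfull hk)
    simp only [Pi.add_apply, mul_add]
    rw [integral_add i3 i4, mul_add, ← e1, ← e2]
    exact integral_add i1 i2
  · intro r f g hf hg e
    simp only [Pi.smul_apply, smul_eq_mul, mul_assoc]
    rw [integral_const_mul, integral_const_mul, e, mul_assoc]
  · intro r f g hf hg e
    simp only [Pi.smul_apply, smul_eq_mul, mul_left_comm _ r]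
    rw [integral_const_mul, integral_const_mul, e]
    ring

end Moments

/-! ### The centred polynomials of edge sets -/

section Gram

variable {n d : ℕ}

/-! ### Monotonicity and submultiplicativity of moments. -/

section MomentBounds

variable {p q lam : ℝ} (hp : 0 ≤ p ∧ p ≤ 1) (hq : 0 ≤ q ∧ q ≤ 1) (hl : 0 ≤ lam ∧ lam ≤ 1)
include hp hq hl

lemma moment_nonneg (F : Finset (Fin n × Fin d)) : 0 ≤ moment p q lam F :=
  mul_nonneg (mul_nonneg (pow_nonneg hl.1 _) (pow_nonneg hp.1 _)) (pow_nonneg hq.1 _)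

lemma moment_anti {F G : Finset (Fin n × Fin d)} (hFG : F ⊆ G) :
    moment p q lam G ≤ moment p q lam F := by
  have h1 := pow_le_pow_of_le_one hl.1 hl.2 (Finset.card_le_card hFG)
  have h2 := pow_le_pow_of_le_one hp.1 hp.2 (Finset.card_le_card (rows_mono hFG))
  have h3 := pow_le_pow_of_le_one hq.1 hq.2 (Finset.card_le_card (cols_mono hFG))
  exact mul_le_mul (mul_le_mul h1 h2 (pow_nonneg hp.1 _) (pow_nonneg hl.1 _)) h3
    (pow_nonneg hq.1 _) (mul_nonneg (pow_nonneg hl.1 _) (pow_nonneg hp.1 _))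

/-- The exponents are subadditive under union and the bases are at most 1. -/
lemma moment_mul_le (F G : Finset (Fin n × Fin d)) :
    moment p q lam F * moment p q lam G ≤ moment p q lam (F ∪ G) := by
  have h1 := pow_le_pow_of_le_one hl.1 hl.2 (Finset.card_union_le F G)
  have h2 := pow_le_pow_of_le_one hp.1 hp.2 (Finset.card_union_le (rows F) (rows G))
  have h3 := pow_le_pow_of_le_one hq.1 hq.2 (Finset.card_union_le (cols F) (cols G))
  rw [← rows_union] at h2
  rw [← cols_union] at h3
  calc moment p q lam F * moment p q lam G
      = lam ^ (F.card + G.card) * p ^ ((rows F).card + (rows G).card) *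
          q ^ ((cols F).card + (cols G).card) := by
        simp only [moment, pow_add]
        ring
    _ ≤ _ := mul_le_mul (mul_le_mul h1 h2 (pow_nonneg hp.1 _) (pow_nonneg hl.1 _)) h3
        (pow_nonneg hq.1 _) (mul_nonneg (pow_nonneg hl.1 _) (pow_nonneg hp.1 _))

lemma prod_moment_le (K : Finset (Finset (Fin n × Fin d))) :
    ∏ C ∈ K, moment p q lam C ≤ moment p q lam (K.biUnion id) := by
  induction K using Finset.induction_on with
  | empty => simp [moment, rows, cols]
  | insert C K hC ih =>
    rw [Finset.prod_insert hC, Finset.biUnion_insert]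
    exact (mul_le_mul_of_nonneg_left ih (moment_nonneg hp hq hl C)).trans
      (moment_mul_le hp hq hl _ _)

lemma moment_le_of_nonempty {F : Finset (Fin n × Fin d)} (hF : F.Nonempty) :
    moment p q lam F ≤ lam := by
  have h1 : lam ^ F.card ≤ lam := pow_le_of_le_one hl.1 hl.2 hF.card_pos.ne'
  have h2 := pow_le_one₀ (n := (rows F).card) hp.1 hp.2
  have h3 := pow_le_one₀ (n := (cols F).card) hq.1 hq.2
  have h4 := pow_nonneg hp.1 (rows F).card
  have h5 := pow_nonneg hq.1 (cols F).card
  calc moment p q lam F ≤ lam * 1 * 1 := mul_le_mul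
        (mul_le_mul h1 h2 h4 hl.1) h3 h5 (by simpa using hl.1)
    _ = lam := by ring

end MomentBounds

variable {Kn Kd : ℕ} {lam : ℝ}

/-- The product of the centred monomials of the edge sets in `K`. -/
def centredProd (p q lam : ℝ) (K : Finset (Finset (Fin n × Fin d)))
    (Y : Fin n × Fin d → ℝ) : ℝ := ∏ C ∈ K, (mono C Y - moment p q lam C)

/-- The product over the components of `A` of the centred monomials. -/
def centredPoly (p q lam : ℝ) (A : Finset (Fin n × Fin d)) (Y : Fin n × Fin d → ℝ) : ℝ :=
  centredProd p q lam (comps A) Y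

lemma polys_mono {P R : Set (Fin n × Fin d)} (h : P ⊆ R) : polys P ≤ polys R := by
  refine Algebra.adjoin_mono ?_
  rintro _ ⟨e, he, rfl⟩
  exact ⟨e, h he, rfl⟩

lemma const_mem_polys (P : Set (Fin n × Fin d)) (c : ℝ) : (fun _ => c) ∈ polys P :=
  (polys P).algebraMap_mem c

lemma sub_const_mem_polys {P : Set (Fin n × Fin d)} {C : Finset (Fin n × Fin d)}
    (hC : ∀ e ∈ C, e ∈ P) (c : ℝ) : (fun Y => mono C Y - c) ∈ polys P :=
  sub_mem (mono_mem_polys hC) (const_mem_polys P c)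

lemma centredProd_mem_polys (p q lam : ℝ) {P : Set (Fin n × Fin d)}
    {K : Finset (Finset (Fin n × Fin d))} (hK : ∀ C ∈ K, ∀ e ∈ C, e ∈ P) :
    centredProd p q lam K ∈ polys P := by
  have : centredProd p q lam K = ∏ C ∈ K, fun Y => mono C Y - moment p q lam C := by
    ext Y
    simp [centredProd]
  rw [this]
  exact Subalgebra.prod_mem _ fun C hC => sub_const_mem_polys (hK C hC) _

lemma centredPoly_mem_polys (p q lam : ℝ) (A : Finset (Fin n × Fin d)) :
    centredPoly p q lam A ∈ polys (Set.univ : Set (Fin n × Fin d)) :=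
  centredProd_mem_polys _ _ _ fun _ _ _ _ => Set.mem_univ _

lemma prod_mono_eq {K : Finset (Finset (Fin n × Fin d))}
    (hK : ∀ C ∈ K, ∀ C' ∈ K, C ≠ C' → Disjoint C C') (Y : Fin n × Fin d → ℝ) :
    ∏ C ∈ K, mono C Y = mono (K.biUnion id) Y := by
  unfold mono
  rw [Finset.prod_biUnion (t := id) fun C hC C' hC' hne => hK C hC C' hC' hne]
  rfl

/-- Expansion of a product of centred monomials. -/
lemma centredProd_eq_sum (p q lam : ℝ) {K : Finset (Finset (Fin n × Fin d))}
    (hK : ∀ C ∈ K, ∀ C' ∈ K, C ≠ C' → Disjoint C C') (Y : Fin n × Fin d → ℝ) :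
    centredProd p q lam K Y = ∑ I ∈ K.powerset,
      (∏ C ∈ K \ I, -moment p q lam C) * mono (I.biUnion id) Y := by
  simp only [centredProd, sub_eq_add_neg]
  rw [Finset.prod_add]
  refine Finset.sum_congr rfl fun I hI => ?_
  have hI' := Finset.mem_powerset.1 hI
  rw [prod_mono_eq fun C hC C' hC' => hK C (hI' hC) C' (hI' hC'), mul_comm]

/-! ### Entries of the Gram matrix. -/

variable (h : Admissible n d Kn Kd lam)
include h

lemma isProbabilityMeasure_mixtureLaw : IsProbabilityMeasure (mixtureLaw n d Kn Kd lam) := by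
  have h1 := integral_mono h ∅
  have h2 : (mono (∅ : Finset (Fin n × Fin d))) = fun _ => 1 := by
    ext Y
    simp [mono]
  rw [h2] at h1
  simp only [moment, rows, cols, Finset.card_empty, Finset.image_empty, pow_zero, mul_one,
    integral_const, smul_eq_mul, Measure.real] at h1
  exact ⟨(ENNReal.toReal_eq_one_iff _).1 h1⟩

lemma integral_centred (C : Finset (Fin n × Fin d)) :
    ∫ Y, (mono C Y - moment ((Kn : ℝ) / n) ((Kd : ℝ) / d) lam C) ∂(mixtureLaw n d Kn Kd lam)
      = 0 := by
  have := isProbabilityMeasure_mixtureLaw h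
  rw [integral_sub (integrable_mono h C) (integrable_const _), integral_mono h]
  simp

lemma integral_centred_sq (C : Finset (Fin n × Fin d)) :
    ∫ Y, (mono C Y - moment ((Kn : ℝ) / n) ((Kd : ℝ) / d) lam C) ^ 2
        ∂(mixtureLaw n d Kn Kd lam) = 1 - moment ((Kn : ℝ) / n) ((Kd : ℝ) / d) lam C ^ 2 := by
  have := isProbabilityMeasure_mixtureLaw h
  set m := moment ((Kn : ℝ) / n) ((Kd : ℝ) / d) lam C with hm
  have hae : (fun Y => (mono C Y - m) ^ 2) =ᵐ[mixtureLaw n d Kn Kd lam]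
      fun Y => (1 + m ^ 2) - (2 * m) * mono C Y := by
    filter_upwards [mono_mul_ae _ (ae_mixtureLaw h) C C] with Y hY
    rw [Pi.mul_apply, symmDiff_self] at hY
    have h1 : mono (⊥ : Finset (Fin n × Fin d)) Y = 1 := by simp [mono]
    rw [h1] at hY
    linear_combination hY
  rw [integral_congr_ae hae, integral_sub (integrable_const _)
    ((integrable_mono h C).const_mul _), integral_const_mul, integral_mono h, ← hm]
  simp only [integral_const, probReal_univ, smul_eq_mul]
  ring

/-- A component of `A` away from `B` makes the mixed moment vanish. -/
lemma integral_centredPoly_mul_eq_zero {A B C : Finset (Fin n × Fin d)} (hC : C ∈ comps A)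
    (hCB : VDisj C B) :
    ∫ Y, centredPoly ((Kn : ℝ) / n) ((Kd : ℝ) / d) lam A Y *
      centredPoly ((Kn : ℝ) / n) ((Kd : ℝ) / d) lam B Y ∂(mixtureLaw n d Kn Kd lam) = 0 := by
  set p := (Kn : ℝ) / n
  set q := (Kd : ℝ) / d
  -- The factor of `C` has mean zero and shares no vertex with any other factor.
  have hfac : ∀ Y, centredPoly p q lam A Y * centredPoly p q lam B Y =
      (mono C Y - moment p q lam C) * (centredProd p q lam ((comps A).erase C) *
        centredProd p q lam (comps B)) Y := by
    intro Y
    rw [centredPoly, centredProd, ← Finset.mul_prod_erase _ _ hC, mul_assoc]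
    rfl
  simp only [hfac]
  rw [integral_mul_of_mem_polys h (P := C) (R := {e | ∀ f ∈ C, ¬ Touch f e})
    (fun e he f hf => hf e he) (sub_const_mem_polys (fun e he => he) _) (mul_mem ?_ ?_),
    integral_centred h, zero_mul]
  · refine centredProd_mem_polys _ _ _ fun C' hC' e he f hf => ?_
    obtain ⟨hne, hC'A⟩ := Finset.mem_erase.1 hC'
    exact vDisj_iff.1 (vDisj_of_ne hC hC'A hne.symm) f hf e he
  · refine centredProd_mem_polys _ _ _ fun C' hC' e he f hf => ?_
    exact vDisj_iff.1 hCB f hf e (subset_of_mem_comps hC' he)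

/-- Squares of centred monomials of separated edge sets factor out of the expectation. -/
lemma integral_prod_sq_mul (K : Finset (Finset (Fin n × Fin d)))
    (hK : ∀ C ∈ K, ∀ C' ∈ K, C ≠ C' → VDisj C C') {g : (Fin n × Fin d → ℝ) → ℝ}
    (hg : g ∈ polys {e : Fin n × Fin d | ∀ C ∈ K, ∀ f ∈ C, ¬ Touch f e}) :
    ∫ Y, (∏ C ∈ K, (mono C Y - moment ((Kn : ℝ) / n) ((Kd : ℝ) / d) lam C) ^ 2) * g Y
        ∂(mixtureLaw n d Kn Kd lam) =
      (∏ C ∈ K, (1 - moment ((Kn : ℝ) / n) ((Kd : ℝ) / d) lam C ^ 2)) *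
        ∫ Y, g Y ∂(mixtureLaw n d Kn Kd lam) := by
  set p := (Kn : ℝ) / n
  set q := (Kd : ℝ) / d
  induction K using Finset.induction_on with
  | empty => simp
  | insert C K hC ih =>
    have hK' : ∀ C' ∈ K, VDisj C C' := fun C' hC' =>
      hK C (Finset.mem_insert_self _ _) C' (Finset.mem_insert_of_mem hC')
        fun hEq => hC (hEq ▸ hC')
    have hfac : ∀ Y, (∏ C' ∈ insert C K, (mono C' Y - moment p q lam C') ^ 2) * g Y =
        (mono C Y - moment p q lam C) ^ 2 *
          (centredProd p q lam K * centredProd p q lam K * g) Y := by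
      intro Y
      rw [Finset.prod_insert hC, mul_assoc, Finset.prod_pow]
      simp only [Pi.mul_apply, centredProd]
      ring
    have hsq : (fun Y => (mono C Y - moment p q lam C) ^ 2) ∈
        polys (C : Set (Fin n × Fin d)) :=
      (polys (C : Set (Fin n × Fin d))).pow_mem (sub_const_mem_polys (fun e he => he) _) 2
    simp only [hfac]
    rw [integral_mul_of_mem_polys h (P := C) (R := {e | ∀ f ∈ C, ¬ Touch f e})
      (fun e he f hf => hf e he) hsq, integral_centred_sq h, Finset.prod_insert hC,
      mul_assoc (1 - moment p q lam C ^ 2), ← ih]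
    · congr 1
      refine integral_congr_ae (Filter.Eventually.of_forall fun Y => ?_)
      simp only [Pi.mul_apply, centredProd, Finset.prod_pow]
      ring
    · exact fun C₁ h₁ C₂ h₂ => hK C₁ (Finset.mem_insert_of_mem h₁) C₂
        (Finset.mem_insert_of_mem h₂)
    · exact polys_mono (Set.ofPred_subset_ofPred.2 fun e he C' hC' =>
        he C' (Finset.mem_insert_of_mem hC')) hg
    · have hmem : centredProd p q lam K ∈ polys {e : Fin n × Fin d | ∀ f ∈ C, ¬ Touch f e} :=
        centredProd_mem_polys _ _ _ fun C' hC' e he f hf => vDisj_iff.1 (hK' C' hC') f hf e he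
      exact mul_mem (mul_mem hmem hmem)
        (polys_mono (Set.ofPred_subset_ofPred.2 fun e he => he C (Finset.mem_insert_self _ _)) hg)

/-- Expanding both products gives 2^(|K|+|L|) terms. Each is, up to sign, a product of moments of
edge sets that together cover `H`, hence at most the moment of `H`. -/
lemma abs_integral_centredProd_mul_le {K L : Finset (Finset (Fin n × Fin d))}
    (hK : ∀ C ∈ K, ∀ C' ∈ K, C ≠ C' → Disjoint C C')
    (hL : ∀ C ∈ L, ∀ C' ∈ L, C ≠ C' → Disjoint C C') {H : Finset (Fin n × Fin d)}
    (hH : ∀ I ⊆ K, ∀ J ⊆ L, H ⊆ ((K \ I).biUnion id ∪ (L \ J).biUnion id) ∪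
      symmDiff (I.biUnion id) (J.biUnion id)) :
    |∫ Y, centredProd ((Kn : ℝ) / n) ((Kd : ℝ) / d) lam K Y *
      centredProd ((Kn : ℝ) / n) ((Kd : ℝ) / d) lam L Y ∂(mixtureLaw n d Kn Kd lam)| ≤
      2 ^ (K.card + L.card) * moment ((Kn : ℝ) / n) ((Kd : ℝ) / d) lam H := by
  have hp := div_nonneg_le_one h.row_le
  have hq := div_nonneg_le_one h.col_le
  have hl : 0 ≤ lam ∧ lam ≤ 1 := ⟨h.nonneg, h.le_one⟩
  set p := (Kn : ℝ) / n
  set q := (Kd : ℝ) / d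
  set μ := mixtureLaw n d Kn Kd lam
  have hmono : ∀ I J : Finset (Finset (Fin n × Fin d)),
      Integrable (fun Y => mono (I.biUnion id) Y * mono (J.biUnion id) Y) μ := fun I J =>
    (integrable_congr (mono_mul_ae _ (ae_mixtureLaw h) _ _)).2 (integrable_mono h _)
  have hval : ∀ I J : Finset (Finset (Fin n × Fin d)),
      ∫ Y, mono (I.biUnion id) Y * mono (J.biUnion id) Y ∂μ =
        moment p q lam (symmDiff (I.biUnion id) (J.biUnion id)) := fun I J => by
    rw [← integral_mono h]
    exact integral_congr_ae (mono_mul_ae _ (ae_mixtureLaw h) _ _)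
  have hexp : ∀ Y, centredProd p q lam K Y * centredProd p q lam L Y =
      ∑ I ∈ K.powerset, ∑ J ∈ L.powerset,
        ((∏ C ∈ K \ I, -moment p q lam C) * ∏ C ∈ L \ J, -moment p q lam C) *
          (mono (I.biUnion id) Y * mono (J.biUnion id) Y) := by
    intro Y
    rw [centredProd_eq_sum _ _ _ hK, centredProd_eq_sum _ _ _ hL, Finset.sum_mul_sum]
    refine Finset.sum_congr rfl fun I _ => Finset.sum_congr rfl fun J _ => ?_
    ring
  simp only [hexp]
  rw [integral_finsetSum _ fun I _ => integrable_finsetSum _ fun J _ => (hmono I J).const_mul _]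
  simp_rw [integral_finsetSum _ fun J _ => (hmono _ J).const_mul _, integral_const_mul, hval]
  have hterm : ∀ I ∈ K.powerset, ∀ J ∈ L.powerset,
      |((∏ C ∈ K \ I, -moment p q lam C) * ∏ C ∈ L \ J, -moment p q lam C) *
        moment p q lam (symmDiff (I.biUnion id) (J.biUnion id))| ≤ moment p q lam H := by
    intro I hI J hJ
    have habs : ∀ F : Finset (Fin n × Fin d), |moment p q lam F| = moment p q lam F := fun F =>
      abs_of_nonneg (moment_nonneg hp hq hl F)
    simp only [abs_mul, Finset.abs_prod, abs_neg, habs]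
    have h1 := prod_moment_le (lam := lam) hp hq hl (K \ I)
    have h2 := prod_moment_le (lam := lam) hp hq hl (L \ J)
    have h0 : ∀ F : Finset (Fin n × Fin d), 0 ≤ moment p q lam F := moment_nonneg hp hq hl
    calc _ ≤ moment p q lam ((K \ I).biUnion id) * moment p q lam ((L \ J).biUnion id) *
          moment p q lam (symmDiff (I.biUnion id) (J.biUnion id)) :=
          mul_le_mul_of_nonneg_right (mul_le_mul h1 h2 (Finset.prod_nonneg fun C _ => h0 C)
            (h0 _)) (h0 _)
      _ ≤ moment p q lam ((K \ I).biUnion id ∪ (L \ J).biUnion id) *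
          moment p q lam (symmDiff (I.biUnion id) (J.biUnion id)) :=
          mul_le_mul_of_nonneg_right (moment_mul_le hp hq hl _ _) (h0 _)
      _ ≤ _ := moment_mul_le hp hq hl _ _
      _ ≤ _ := moment_anti hp hq hl
          (hH I (Finset.mem_powerset.1 hI) J (Finset.mem_powerset.1 hJ))
  refine (Finset.abs_sum_le_sum_abs _ _).trans ((Finset.sum_le_sum fun I hI =>
    (Finset.abs_sum_le_sum_abs _ _).trans (Finset.sum_le_sum fun J hJ =>
      hterm I hI J hJ)).trans (le_of_eq ?_))
  simp only [Finset.sum_const, Finset.card_powerset, nsmul_eq_mul, pow_add]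
  push_cast
  ring

/-- The common components factor out of the mixed moments. -/
lemma integral_centredPoly_mul_eq (A B : Finset (Fin n × Fin d)) :
    ∫ Y, centredPoly ((Kn : ℝ) / n) ((Kd : ℝ) / d) lam A Y *
      centredPoly ((Kn : ℝ) / n) ((Kd : ℝ) / d) lam B Y ∂(mixtureLaw n d Kn Kd lam) =
    (∏ C ∈ comps A ∩ comps B, (1 - moment ((Kn : ℝ) / n) ((Kd : ℝ) / d) lam C ^ 2)) *
      ∫ Y, centredProd ((Kn : ℝ) / n) ((Kd : ℝ) / d) lam (comps A \ comps B) Y *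
        centredProd ((Kn : ℝ) / n) ((Kd : ℝ) / d) lam (comps B \ comps A) Y
          ∂(mixtureLaw n d Kn Kd lam) := by
  set p := (Kn : ℝ) / n
  set q := (Kd : ℝ) / d
  have hmem : centredProd p q lam (comps A \ comps B) * centredProd p q lam (comps B \ comps A) ∈
      polys {e : Fin n × Fin d | ∀ C ∈ comps A ∩ comps B, ∀ f ∈ C, ¬ Touch f e} := by
    refine mul_mem ?_ ?_
    · refine centredProd_mem_polys _ _ _ fun C' hC' e he C hC f hf => ?_
      obtain ⟨h1, h2⟩ := Finset.mem_sdiff.1 hC'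
      obtain ⟨h3, h4⟩ := Finset.mem_inter.1 hC
      exact vDisj_iff.1 (vDisj_of_ne h3 h1 fun hEq => h2 (hEq ▸ h4)) f hf e he
    · refine centredProd_mem_polys _ _ _ fun C' hC' e he C hC f hf => ?_
      obtain ⟨h1, h2⟩ := Finset.mem_sdiff.1 hC'
      obtain ⟨h3, h4⟩ := Finset.mem_inter.1 hC
      exact vDisj_iff.1 (vDisj_of_ne h4 h1 fun hEq => h2 (hEq ▸ h3)) f hf e he
  refine Eq.trans ?_ (integral_prod_sq_mul h (comps A ∩ comps B) (fun C hC C' hC' =>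
    vDisj_of_ne (Finset.mem_inter.1 hC).1 (Finset.mem_inter.1 hC').1) hmem)
  refine integral_congr_ae (Filter.Eventually.of_forall fun Y => ?_)
  have hA : centredPoly p q lam A Y = centredProd p q lam (comps A \ comps B) Y *
      ∏ C ∈ comps A ∩ comps B, (mono C Y - moment p q lam C) := by
    simp only [centredPoly, centredProd]
    rw [← Finset.prod_union (Finset.disjoint_sdiff_inter _ _), Finset.sdiff_union_inter]
  have hB : centredPoly p q lam B Y = centredProd p q lam (comps B \ comps A) Y *
      ∏ C ∈ comps A ∩ comps B, (mono C Y - moment p q lam C) := by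
    simp only [centredPoly, centredProd]
    rw [Finset.inter_comm, ← Finset.prod_union (Finset.disjoint_sdiff_inter _ _),
      Finset.sdiff_union_inter]
  simp only [hA, hB, Finset.prod_pow]
  ring

lemma one_sub_moment_sq_mem (C : Finset (Fin n × Fin d)) :
    0 ≤ 1 - moment ((Kn : ℝ) / n) ((Kd : ℝ) / d) lam C ^ 2 ∧
      1 - moment ((Kn : ℝ) / n) ((Kd : ℝ) / d) lam C ^ 2 ≤ 1 := by
  have h0 := moment_nonneg (lam := lam) (div_nonneg_le_one h.row_le)
    (div_nonneg_le_one h.col_le) ⟨h.nonneg, h.le_one⟩ C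
  have h1 := moment_anti (lam := lam) (div_nonneg_le_one h.row_le)
    (div_nonneg_le_one h.col_le) ⟨h.nonneg, h.le_one⟩ (Finset.empty_subset C)
  have h2 : moment ((Kn : ℝ) / n) ((Kd : ℝ) / d) lam (∅ : Finset (Fin n × Fin d)) = 1 := by
    simp [moment, rows, cols]
  rw [h2] at h1
  constructor <;> nlinarith

/-- Common components contribute a factor at most 1. At most 4|A∆B| components are unmatched, whence
2⁴ = 16. -/
lemma abs_integral_centredPoly_mul_le (A B : Finset (Fin n × Fin d)) :
    |∫ Y, centredPoly ((Kn : ℝ) / n) ((Kd : ℝ) / d) lam A Y *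
      centredPoly ((Kn : ℝ) / n) ((Kd : ℝ) / d) lam B Y ∂(mixtureLaw n d Kn Kd lam)| ≤
    16 ^ (symmDiff A B).card *
      moment ((Kn : ℝ) / n) ((Kd : ℝ) / d) lam (symmDiff A B) := by
  have h0 := moment_nonneg (lam := lam) (div_nonneg_le_one h.row_le)
    (div_nonneg_le_one h.col_le) ⟨h.nonneg, h.le_one⟩ (symmDiff A B)
  -- An edge of `A` outside `B` lies in an unmatched component: either its mean was chosen, or its
  -- monomial, in which case the edge cannot cancel against an edge of `B`.
  have hmemA : ∀ {A B : Finset (Fin n × Fin d)} {I J : Finset (Finset (Fin n × Fin d))},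
      I ⊆ comps A \ comps B → J ⊆ comps B \ comps A → ∀ e ∈ A, e ∉ B →
      e ∈ ((comps A \ comps B) \ I).biUnion id ∨
        (e ∈ I.biUnion id ∧ e ∉ J.biUnion id) := by
    intro A B I J hI hJ e heA heB
    have hC : edgeClass A e ∈ comps A \ comps B := Finset.mem_sdiff.2
      ⟨edgeClass_mem_comps heA, fun hcon =>
        heB (subset_of_mem_comps hcon (mem_edgeClass_self heA))⟩
    by_cases heI : edgeClass A e ∈ I
    · exact Or.inr ⟨Finset.mem_biUnion.2 ⟨_, heI, mem_edgeClass_self heA⟩, fun hcon =>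
        heB (biUnion_comps_subset (hJ.trans Finset.sdiff_subset) hcon)⟩
    · exact Or.inl (Finset.mem_biUnion.2
        ⟨_, Finset.mem_sdiff.2 ⟨hC, heI⟩, mem_edgeClass_self heA⟩)
  have key := abs_integral_centredProd_mul_le h (K := comps A \ comps B) (L := comps B \ comps A)
    (H := symmDiff A B)
    (fun C hC C' hC' hne => (vDisj_of_ne (Finset.mem_sdiff.1 hC).1
      (Finset.mem_sdiff.1 hC').1 hne).disjoint)
    (fun C hC C' hC' hne => (vDisj_of_ne (Finset.mem_sdiff.1 hC).1
      (Finset.mem_sdiff.1 hC').1 hne).disjoint) (fun I hI J hJ e he => by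
      simp only [Finset.mem_union, Finset.mem_symmDiff]
      rcases Finset.mem_symmDiff.1 he with ⟨h1, h2⟩ | ⟨h1, h2⟩
      · rcases hmemA hI hJ e h1 h2 with h3 | h3
        · exact Or.inl (Or.inl h3)
        · exact Or.inr (Or.inl h3)
      · rcases hmemA hJ hI e h1 h2 with h3 | h3
        · exact Or.inl (Or.inr h3)
        · exact Or.inr (Or.inr h3))
  rw [integral_centredPoly_mul_eq h, abs_mul]
  have hprod : |∏ C ∈ comps A ∩ comps B,
      (1 - moment ((Kn : ℝ) / n) ((Kd : ℝ) / d) lam C ^ 2)| ≤ 1 := by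
    rw [abs_of_nonneg (Finset.prod_nonneg fun C _ => (one_sub_moment_sq_mem h C).1)]
    exact Finset.prod_le_one (fun C _ => (one_sub_moment_sq_mem h C).1)
      fun C _ => (one_sub_moment_sq_mem h C).2
  have hcard : (comps A \ comps B).card + (comps B \ comps A).card ≤
      4 * (symmDiff A B).card := by
    have h1 := card_comps_sdiff_le A B
    have h2 := card_comps_sdiff_le B A
    rw [symmDiff_comm] at h2
    omega
  calc _ ≤ 1 * (2 ^ ((comps A \ comps B).card + (comps B \ comps A).card) *
        moment ((Kn : ℝ) / n) ((Kd : ℝ) / d) lam (symmDiff A B)) :=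
        mul_le_mul hprod key (abs_nonneg _) zero_le_one
    _ ≤ 2 ^ (4 * (symmDiff A B).card) *
        moment ((Kn : ℝ) / n) ((Kd : ℝ) / d) lam (symmDiff A B) := by
        rw [one_mul]
        exact mul_le_mul_of_nonneg_right (pow_le_pow_right₀ (by norm_num) hcard) h0
    _ = _ := by
        rw [pow_mul]
        norm_num

/-- For `A = B` every component is common, leaving ∏(1 - m_C²) with m_C² ≤ λ and at most |A|
factors; a Bernoulli-type inequality concludes. -/
lemma abs_integral_centredPoly_sq_sub_one_le (A : Finset (Fin n × Fin d)) :
    |∫ Y, centredPoly ((Kn : ℝ) / n) ((Kd : ℝ) / d) lam A Y *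
      centredPoly ((Kn : ℝ) / n) ((Kd : ℝ) / d) lam A Y ∂(mixtureLaw n d Kn Kd lam) - 1| ≤
    A.card * lam := by
  have := isProbabilityMeasure_mixtureLaw h
  rw [integral_centredPoly_mul_eq h]
  simp only [Finset.sdiff_self, Finset.inter_self, centredProd, Finset.prod_empty, mul_one,
    integral_const, probReal_univ, smul_eq_mul]
  have hle := Finset.prod_le_one (s := comps A) (fun C _ => (one_sub_moment_sq_mem h C).1)
      fun C _ => (one_sub_moment_sq_mem h C).2
  have hge : ∀ K ⊆ comps A, 1 - K.card * lam ≤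
      ∏ C ∈ K, (1 - moment ((Kn : ℝ) / n) ((Kd : ℝ) / d) lam C ^ 2) := by
    intro K
    induction K using Finset.induction_on with
    | empty => simp
    | insert C K hC ih =>
      intro hK
      have hne := nonempty_of_mem_comps (hK (Finset.mem_insert_self C K))
      have h1 := moment_le_of_nonempty (lam := lam) (div_nonneg_le_one h.row_le)
        (div_nonneg_le_one h.col_le) ⟨h.nonneg, h.le_one⟩ hne
      have h0 := moment_nonneg (lam := lam) (div_nonneg_le_one h.row_le)
        (div_nonneg_le_one h.col_le) ⟨h.nonneg, h.le_one⟩ C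
      have hKle := Finset.prod_le_one (s := K) (fun C _ => (one_sub_moment_sq_mem h C).1)
        fun C _ => (one_sub_moment_sq_mem h C).2
      have hK0 := Finset.prod_nonneg (s := K) (fun C _ => (one_sub_moment_sq_mem h C).1)
      have hsq : moment ((Kn : ℝ) / n) ((Kd : ℝ) / d) lam C ^ 2 ≤ lam := by
        nlinarith [h.le_one]
      rw [Finset.prod_insert hC, Finset.card_insert_of_notMem hC]
      push_cast
      nlinarith [ih ((Finset.subset_insert _ _).trans hK),
        mul_le_mul hsq hKle hK0 h.nonneg]
  have h1 := hge _ subset_rfl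
  have h2 : ((comps A).card : ℝ) * lam ≤ A.card * lam :=
    mul_le_mul_of_nonneg_right (by exact_mod_cast card_comps_le A) h.nonneg
  rw [abs_le]
  constructor <;> nlinarith [h.nonneg]

end Gram

/-! ### Counting edge sets by their new vertices -/

section Counting

variable {n d : ℕ}

/-- The weight `n ^ (-a) * d ^ (-b)`, where `a` and `b` are the numbers of rows and columns of `F`
outside `R` and `T`. -/
def newWeight (R : Finset (Fin n)) (T : Finset (Fin d)) (F : Finset (Fin n × Fin d)) : ℝ :=
  (n : ℝ)⁻¹ ^ (rows F \ R).card * (d : ℝ)⁻¹ ^ (cols F \ T).card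

lemma newWeight_nonneg (R : Finset (Fin n)) (T : Finset (Fin d)) (F : Finset (Fin n × Fin d)) :
    0 ≤ newWeight R T F := by
  unfold newWeight
  positivity

lemma pow_card_insert_sdiff {m : ℕ} (x : ℝ) (X R : Finset (Fin m)) (i : Fin m) :
    x ^ (insert i X \ R).card = x ^ (X \ R).card * if i ∈ X ∪ R then 1 else x := by
  by_cases hR : i ∈ R
  · rw [Finset.insert_sdiff_of_mem _ hR, if_pos (Finset.mem_union_right _ hR), mul_one]
  · by_cases hX : i ∈ X
    · rw [Finset.insert_eq_of_mem hX, if_pos (Finset.mem_union_left _ hX), mul_one]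
    · rw [Finset.insert_sdiff_of_notMem _ hR, Finset.card_insert_of_notMem (by simp [hX]),
        if_neg (by simp [hX, hR]), pow_succ]

lemma newWeight_insert (R : Finset (Fin n)) (T : Finset (Fin d)) (F : Finset (Fin n × Fin d))
    (e : Fin n × Fin d) :
    newWeight R T (insert e F) = newWeight R T F *
      ((if e.1 ∈ rows F ∪ R then 1 else (n : ℝ)⁻¹) *
        if e.2 ∈ cols F ∪ T then 1 else (d : ℝ)⁻¹) := by
  have h1 : rows (insert e F) = insert e.1 (rows F) := Finset.image_insert _ _ _
  have h2 : cols (insert e F) = insert e.2 (cols F) := Finset.image_insert _ _ _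
  simp only [newWeight, h1, h2, pow_card_insert_sdiff]
  ring

/-- Choosing one endpoint: old vertices cost 1 each, and all new ones together cost at most 1. -/
lemma sum_ite_inv_le {m : ℕ} (X : Finset (Fin m)) :
    ∑ i : Fin m, (if i ∈ X then 1 else (m : ℝ)⁻¹) ≤ X.card + 1 := by
  calc ∑ i : Fin m, (if i ∈ X then 1 else (m : ℝ)⁻¹)
      ≤ ∑ i : Fin m, ((if i ∈ X then 1 else 0) + (m : ℝ)⁻¹) := by
        refine Finset.sum_le_sum fun i _ => ?_
        have : (0 : ℝ) ≤ (m : ℝ)⁻¹ := by positivity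
        split_ifs <;> linarith
    _ = X.card + m * (m : ℝ)⁻¹ := by
        rw [Finset.sum_add_distrib]
        simp
    _ ≤ X.card + 1 := by
        gcongr
        exact mul_inv_le_one

/-- Every set of f+1 edges arises by inserting an edge into a set of f edges; overcounting is
harmless because weights are nonnegative. -/
lemma sum_newWeight_succ_le (R : Finset (Fin n)) (T : Finset (Fin d)) (f : ℕ) :
    ∑ F ∈ Finset.powersetCard (f + 1) (Finset.univ : Finset (Fin n × Fin d)), newWeight R T F ≤
      ∑ F ∈ Finset.powersetCard f (Finset.univ : Finset (Fin n × Fin d)), ∑ e,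
        newWeight R T (insert e F) := by
  rw [← Finset.sum_product']
  have hsub : Finset.powersetCard (f + 1) (Finset.univ : Finset (Fin n × Fin d)) ⊆
      (Finset.powersetCard f (Finset.univ : Finset (Fin n × Fin d)) ×ˢ
        (Finset.univ : Finset (Fin n × Fin d))).image fun x => insert x.2 x.1 := by
    intro F hF
    obtain ⟨_, hF⟩ := Finset.mem_powersetCard.1 hF
    obtain ⟨e, he⟩ : F.Nonempty := Finset.card_pos.1 (by omega)
    refine Finset.mem_image.2 ⟨(F.erase e, e), ?_, Finset.insert_erase he⟩
    have := Finset.card_erase_of_mem he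
    simp only [Finset.mem_product, Finset.mem_powersetCard, Finset.subset_univ, true_and,
      Finset.mem_univ, and_true]
    omega
  exact (Finset.sum_le_sum_of_subset_of_nonneg hsub fun F _ _ => newWeight_nonneg R T F).trans
    (Finset.sum_image_le_of_nonneg fun F _ => newWeight_nonneg R T F)

/-- Edges are added one at a time; fewer than `M` insertions keep the old vertices on each side at
most `M`, so each endpoint contributes at most M+1. -/
lemma sum_newWeight_le (R : Finset (Fin n)) (T : Finset (Fin d)) (M : ℕ) (f : ℕ)
    (hR : R.card + f ≤ M) (hT : T.card + f ≤ M) :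
    ∑ F ∈ Finset.powersetCard f (Finset.univ : Finset (Fin n × Fin d)), newWeight R T F ≤
      (((M : ℝ) + 1) ^ 2) ^ f := by
  induction f with
  | zero => simp [newWeight, rows, cols]
  | succ f ih =>
    have hstep : ∀ F ∈ Finset.powersetCard f (Finset.univ : Finset (Fin n × Fin d)),
        ∑ e, newWeight R T (insert e F) ≤ newWeight R T F * ((M : ℝ) + 1) ^ 2 := by
      intro F hF
      obtain ⟨_, hF⟩ := Finset.mem_powersetCard.1 hF
      simp only [newWeight_insert, ← Finset.mul_sum]
      refine mul_le_mul_of_nonneg_left ?_ (newWeight_nonneg R T F)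
      rw [Fintype.sum_prod_type, sq]
      refine (Finset.sum_mul_sum Finset.univ Finset.univ
        (fun i => if i ∈ rows F ∪ R then 1 else (n : ℝ)⁻¹)
        fun k => if k ∈ cols F ∪ T then 1 else (d : ℝ)⁻¹).symm.trans_le ?_
      have hr : (((rows F ∪ R).card : ℕ) : ℝ) + 1 ≤ M + 1 := by
        have := Finset.card_union_le (rows F) R
        have := card_rows_le F
        have : (rows F ∪ R).card ≤ M := by omega
        gcongr
      have hc : (((cols F ∪ T).card : ℕ) : ℝ) + 1 ≤ M + 1 := by
        have := Finset.card_union_le (cols F) T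
        have := card_cols_le F
        have : (cols F ∪ T).card ≤ M := by omega
        gcongr
      refine mul_le_mul ((sum_ite_inv_le _).trans hr) ((sum_ite_inv_le _).trans hc) ?_
        (by positivity)
      exact Finset.sum_nonneg fun i _ => by split_ifs <;> positivity
    calc _ ≤ _ := sum_newWeight_succ_le R T f
      _ ≤ _ := Finset.sum_le_sum hstep
      _ ≤ _ := by
        rw [← Finset.sum_mul, pow_succ]
        exact mul_le_mul_of_nonneg_right (ih (by omega) (by omega)) (by positivity)

lemma sum_pow_le_two_mul {x : ℝ} (h0 : 0 ≤ x) (h1 : x ≤ 1 / 2) (m : ℕ) :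
    ∑ f ∈ Finset.Icc 1 m, x ^ f ≤ 2 * x := by
  -- The subtracted tail makes the induction close, as 2x ≤ 1.
  have : ∀ m : ℕ, ∑ f ∈ Finset.Icc 1 m, x ^ f ≤ 2 * x - 2 * (x * x ^ m) := by
    intro m
    induction m with
    | zero => simp
    | succ m ih =>
      rw [Finset.sum_Icc_succ_top (by omega), pow_succ]
      have := pow_nonneg h0 m
      nlinarith [mul_nonneg h0 this, mul_le_mul_of_nonneg_right h1 (mul_nonneg h0 this)]
  exact (this m).trans (by have := mul_nonneg h0 (pow_nonneg h0 m); linarith)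

/-- The total weight of the nonempty edge sets with at most `m` edges. -/
lemma sum_pow_mul_newWeight_le {y : ℝ} (hy : 0 ≤ y) (R : Finset (Fin n)) (T : Finset (Fin d))
    (M m : ℕ) (hR : R.card + m ≤ M) (hT : T.card + m ≤ M)
    (hM : y * ((M : ℝ) + 1) ^ 2 ≤ 1 / 2) :
    ∑ F : Finset (Fin n × Fin d) with 1 ≤ F.card ∧ F.card ≤ m, y ^ F.card * newWeight R T F ≤
      2 * (y * ((M : ℝ) + 1) ^ 2) := by
  have hmaps : ∀ F ∈ (Finset.univ.filter fun F : Finset (Fin n × Fin d) =>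
      1 ≤ F.card ∧ F.card ≤ m), F.card ∈ Finset.Icc 1 m := fun F hF =>
    Finset.mem_Icc.2 (Finset.mem_filter.1 hF).2
  rw [← Finset.sum_fiberwise_of_maps_to hmaps]
  refine le_trans (Finset.sum_le_sum fun f hf => ?_)
    (sum_pow_le_two_mul (by positivity) hM m)
  have hfm := Finset.mem_Icc.1 hf
  calc _ ≤ ∑ F ∈ Finset.powersetCard f (Finset.univ : Finset (Fin n × Fin d)),
        y ^ f * newWeight R T F := by
        refine (Finset.sum_congr rfl fun F hF => ?_).trans_le
          (Finset.sum_le_sum_of_subset_of_nonneg (fun F hF => ?_) fun F _ _ =>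
            mul_nonneg (pow_nonneg hy f) (newWeight_nonneg R T F))
        · rw [(Finset.mem_filter.1 hF).2]
        · exact Finset.mem_powersetCard.2 ⟨Finset.subset_univ _, (Finset.mem_filter.1 hF).2⟩
    _ ≤ _ := by
        rw [← Finset.mul_sum, mul_pow]
        exact mul_le_mul_of_nonneg_left (sum_newWeight_le R T M f (by omega) (by omega))
          (pow_nonneg hy f)

end Counting

/-! ### The Schur test -/

/-- Use 2|x_a x_b| ≤ x_a² w_b/w_a + x_b² w_a/w_b; by symmetry of `k` both halves reduce to the
weighted row sums. -/
lemma schur_test {ι : Type*} (s : Finset ι) (k : ι → ι → ℝ) (w x : ι → ℝ) (δ : ℝ)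
    (hk : ∀ a ∈ s, ∀ b ∈ s, k a b = k b a) (hw : ∀ a ∈ s, 0 < w a)
    (hrow : ∀ a ∈ s, ∑ b ∈ s, |k a b| * w b ≤ δ * w a) :
    |∑ a ∈ s, ∑ b ∈ s, x a * x b * k a b| ≤ δ * ∑ a ∈ s, x a ^ 2 := by
  have hpt : ∀ a ∈ s, ∀ b ∈ s, |x a * x b * k a b| ≤
      x a ^ 2 / w a * (|k a b| * w b) / 2 + x b ^ 2 / w b * (|k b a| * w a) / 2 := by
    intro a ha b hb
    have hwa := hw a ha
    have hwb := hw b hb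
    rw [hk b hb a ha, abs_mul]
    have : |x a * x b| ≤ x a ^ 2 / w a * w b / 2 + x b ^ 2 / w b * w a / 2 := by
      rw [abs_mul, ← sq_abs (x a), ← sq_abs (x b), div_mul_eq_mul_div,
        div_mul_eq_mul_div, div_div, div_div,
        div_add_div _ _ (by positivity) (by positivity), le_div_iff₀ (by positivity)]
      nlinarith [sq_nonneg (|x a| * w b - |x b| * w a)]
    calc |x a * x b| * |k a b|
        ≤ (x a ^ 2 / w a * w b / 2 + x b ^ 2 / w b * w a / 2) * |k a b| :=
          mul_le_mul_of_nonneg_right this (abs_nonneg _)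
      _ = _ := by ring
  have hhalf : ∑ a ∈ s, ∑ b ∈ s, x a ^ 2 / w a * (|k a b| * w b) / 2 ≤
      δ * (∑ a ∈ s, x a ^ 2) / 2 := by
    rw [Finset.mul_sum, Finset.sum_div]
    refine Finset.sum_le_sum fun a ha => ?_
    rw [← Finset.sum_div, ← Finset.mul_sum]
    have hwa := hw a ha
    have := mul_le_mul_of_nonneg_left (hrow a ha) (div_nonneg (sq_nonneg (x a)) hwa.le)
    have h2 : x a ^ 2 / w a * (δ * w a) = δ * x a ^ 2 := by field_simp
    linarith
  calc _ ≤ ∑ a ∈ s, |∑ b ∈ s, x a * x b * k a b| := Finset.abs_sum_le_sum_abs _ _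
    _ ≤ ∑ a ∈ s, ∑ b ∈ s, |x a * x b * k a b| :=
      Finset.sum_le_sum fun a _ => Finset.abs_sum_le_sum_abs _ _
    _ ≤ ∑ a ∈ s, ∑ b ∈ s, (x a ^ 2 / w a * (|k a b| * w b) / 2 +
        x b ^ 2 / w b * (|k b a| * w a) / 2) :=
      Finset.sum_le_sum fun a ha => Finset.sum_le_sum fun b hb => hpt a ha b hb
    _ = (∑ a ∈ s, ∑ b ∈ s, x a ^ 2 / w a * (|k a b| * w b) / 2) +
        ∑ b ∈ s, ∑ a ∈ s, x b ^ 2 / w b * (|k b a| * w a) / 2 := by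
      simp only [Finset.sum_add_distrib]
      congr 1
      exact Finset.sum_comm
    _ ≤ _ := by linarith

/-! ### Near-orthonormality of the centred polynomials -/

section NearOrthonormal

variable {n d Kn Kd : ℕ} {lam : ℝ}

/-- This identity merges the half powers from the moment and from the weight of `B` into the weight
of `A` and full powers for new vertices. -/
lemma card_add_card_symmDiff {α : Type*} [DecidableEq α] (X Z : Finset α) :
    Z.card + (symmDiff X Z).card = X.card + 2 * (Z \ X).card := by
  have h1 : (symmDiff X Z).card = (X \ Z).card + (Z \ X).card := by
    rw [symmDiff_def, Finset.sup_eq_union, Finset.card_union_of_disjoint disjoint_sdiff_sdiff]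
  have h2 := Finset.card_sdiff_add_card_inter X Z
  have h3 := Finset.card_sdiff_add_card_inter Z X
  rw [Finset.inter_comm] at h3
  omega

lemma rows_symmDiff_sdiff (A B : Finset (Fin n × Fin d)) :
    rows (symmDiff A B) \ rows A = rows B \ rows A := by
  ext i
  simp only [Finset.mem_sdiff, mem_rows, Finset.mem_symmDiff]
  constructor
  · rintro ⟨⟨k, hk | hk⟩, hi⟩
    · exact absurd ⟨k, hk.1⟩ hi
    · exact ⟨⟨k, hk.1⟩, hi⟩
  · rintro ⟨⟨k, hk⟩, hi⟩
    exact ⟨⟨k, Or.inr ⟨hk, fun h => hi ⟨k, h⟩⟩⟩, hi⟩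

lemma cols_symmDiff_sdiff (A B : Finset (Fin n × Fin d)) :
    cols (symmDiff A B) \ cols A = cols B \ cols A := by
  ext k
  simp only [Finset.mem_sdiff, mem_cols, Finset.mem_symmDiff]
  constructor
  · rintro ⟨⟨i, hi | hi⟩, hk⟩
    · exact absurd ⟨i, hi.1⟩ hk
    · exact ⟨⟨i, hi.1⟩, hk⟩
  · rintro ⟨⟨i, hi⟩, hk⟩
    exact ⟨⟨i, Or.inr ⟨hi, fun h => hk ⟨i, h⟩⟩⟩, hk⟩

lemma symmDiff_rows_subset (A B : Finset (Fin n × Fin d)) :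
    symmDiff (rows A) (rows B) ⊆ rows (symmDiff A B) := by
  intro i hi
  simp only [Finset.mem_symmDiff, mem_rows] at hi ⊢
  rcases hi with ⟨⟨k, hk⟩, hn⟩ | ⟨⟨k, hk⟩, hn⟩
  · exact ⟨k, Or.inl ⟨hk, fun h => hn ⟨k, h⟩⟩⟩
  · exact ⟨k, Or.inr ⟨hk, fun h => hn ⟨k, h⟩⟩⟩

lemma symmDiff_cols_subset (A B : Finset (Fin n × Fin d)) :
    symmDiff (cols A) (cols B) ⊆ cols (symmDiff A B) := by
  intro k hk
  simp only [Finset.mem_symmDiff, mem_cols] at hk ⊢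
  rcases hk with ⟨⟨i, hi⟩, hn⟩ | ⟨⟨i, hi⟩, hn⟩
  · exact ⟨i, Or.inl ⟨hi, fun h => hn ⟨i, h⟩⟩⟩
  · exact ⟨i, Or.inr ⟨hi, fun h => hn ⟨i, h⟩⟩⟩

/-- The weights of the Schur test. -/
def schurWeight (A : Finset (Fin n × Fin d)) : ℝ :=
  (√(n : ℝ))⁻¹ ^ (rows A).card * (√(d : ℝ))⁻¹ ^ (cols A).card

lemma moment_mul_schurWeight_le {p q ε : ℝ} (hp : 0 ≤ p ∧ p ≤ 1) (hq : 0 ≤ q ∧ q ≤ 1)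
    (hl0 : 0 ≤ lam) (hl : lam ≤ ε) (hlp : lam * p ≤ ε * (√(n : ℝ))⁻¹)
    (hlq : lam * q ≤ ε * (√(d : ℝ))⁻¹) (A B : Finset (Fin n × Fin d))
    (hcard : (symmDiff (rows A) (rows B)).card + (symmDiff (cols A) (cols B)).card ≤
      (symmDiff A B).card) :
    moment p q lam (symmDiff A B) * schurWeight B ≤
      ε ^ (symmDiff A B).card * newWeight (rows A) (cols A) (symmDiff A B) * schurWeight A := by
  have hε : 0 ≤ ε := hl0.trans hl
  set u := (√(n : ℝ))⁻¹ with hu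
  set v := (√(d : ℝ))⁻¹ with hv
  have hu0 : 0 ≤ u := by positivity
  have hv0 : 0 ≤ v := by positivity
  have hu2 : (n : ℝ)⁻¹ = u ^ 2 := by rw [hu, inv_pow, Real.sq_sqrt (by positivity)]
  have hv2 : (d : ℝ)⁻¹ = v ^ 2 := by rw [hv, inv_pow, Real.sq_sqrt (by positivity)]
  obtain ⟨c, hc⟩ := Nat.exists_eq_add_of_le hcard
  have hr := card_add_card_symmDiff (rows A) (rows B)
  have hs := card_add_card_symmDiff (cols A) (cols B)
  have hpr := pow_le_pow_of_le_one hp.1 hp.2 (Finset.card_le_card (symmDiff_rows_subset A B))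
  have hqc := pow_le_pow_of_le_one hq.1 hq.2 (Finset.card_le_card (symmDiff_cols_subset A B))
  unfold newWeight schurWeight moment
  rw [rows_symmDiff_sdiff, cols_symmDiff_sdiff, hu2, hv2]
  set a := (symmDiff (rows A) (rows B)).card
  set b := (symmDiff (cols A) (cols B)).card
  set f := (symmDiff A B).card
  have hmom : lam ^ f * p ^ (rows (symmDiff A B)).card * q ^ (cols (symmDiff A B)).card ≤
      ε ^ f * u ^ a * v ^ b := by
    calc _ ≤ lam ^ f * p ^ a * q ^ b :=
          mul_le_mul (mul_le_mul_of_nonneg_left hpr (pow_nonneg hl0 _)) hqc (pow_nonneg hq.1 _)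
            (mul_nonneg (pow_nonneg hl0 _) (pow_nonneg hp.1 _))
      -- `hcard` supplies one factor λ for each of the `a + b` gained or lost vertices; `c` edges
      -- are left over.
      _ = (lam * p) ^ a * (lam * q) ^ b * lam ^ c := by
          rw [hc]
          ring
      _ ≤ (ε * u) ^ a * (ε * v) ^ b * ε ^ c := by
          have h1 := mul_nonneg hl0 hp.1
          have h2 := mul_nonneg hl0 hq.1
          gcongr
      _ = _ := by
          rw [hc]
          ring
  calc _ ≤ ε ^ f * u ^ a * v ^ b * (u ^ (rows B).card * v ^ (cols B).card) :=
        mul_le_mul_of_nonneg_right hmom (by positivity)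
    _ = ε ^ f * u ^ ((rows B).card + a) * v ^ ((cols B).card + b) := by ring
    _ = _ := by
        rw [hr, hs]
        ring

variable (h : Admissible n d Kn Kd lam)
include h

/-- Apart from the weight of `A`, the bound depends on `B` only through A∆B, so a row sum becomes a
sum over the difference set. -/
lemma integral_mul_schurWeight_le {ε : ℝ} (hl : lam ≤ ε)
    (hlp : lam * ((Kn : ℝ) / n) ≤ ε * (√(n : ℝ))⁻¹)
    (hlq : lam * ((Kd : ℝ) / d) ≤ ε * (√(d : ℝ))⁻¹) (A B : Finset (Fin n × Fin d)) :
    |∫ Y, centredPoly ((Kn : ℝ) / n) ((Kd : ℝ) / d) lam A Y *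
      centredPoly ((Kn : ℝ) / n) ((Kd : ℝ) / d) lam B Y ∂(mixtureLaw n d Kn Kd lam)| *
        schurWeight B ≤ (16 * ε) ^ (symmDiff A B).card *
          newWeight (rows A) (cols A) (symmDiff A B) * schurWeight A := by
  have hε : 0 ≤ ε := h.nonneg.trans hl
  have hw : ∀ A : Finset (Fin n × Fin d), 0 ≤ schurWeight A := fun A => by
    unfold schurWeight
    positivity
  have hrhs : 0 ≤ (16 * ε) ^ (symmDiff A B).card *
      newWeight (rows A) (cols A) (symmDiff A B) * schurWeight A :=
    mul_nonneg (mul_nonneg (by positivity) (newWeight_nonneg _ _ _)) (hw A)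
  by_cases hA : ∃ C ∈ comps A, VDisj C B
  · obtain ⟨C, hC, hCB⟩ := hA
    rw [integral_centredPoly_mul_eq_zero h hC hCB, abs_zero, zero_mul]
    exact hrhs
  by_cases hB : ∃ C ∈ comps B, VDisj C A
  · obtain ⟨C, hC, hCB⟩ := hB
    have h0 := integral_centredPoly_mul_eq_zero h hC hCB
    simp only [mul_comm (centredPoly _ _ lam B _)] at h0
    rw [h0, abs_zero, zero_mul]
    exact hrhs
  push Not at hA hB
  have hcard := card_gained_add_lost_le hA hB
  have hm := moment_mul_schurWeight_le (div_nonneg_le_one h.row_le) (div_nonneg_le_one h.col_le)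
    h.nonneg hl hlp hlq A B hcard
  calc _ ≤ 16 ^ (symmDiff A B).card *
        moment ((Kn : ℝ) / n) ((Kd : ℝ) / d) lam (symmDiff A B) * schurWeight B :=
        mul_le_mul_of_nonneg_right (abs_integral_centredPoly_mul_le h A B) (hw B)
    _ = 16 ^ (symmDiff A B).card *
        (moment ((Kn : ℝ) / n) ((Kd : ℝ) / d) lam (symmDiff A B) * schurWeight B) := by ring
    _ ≤ 16 ^ (symmDiff A B).card * (ε ^ (symmDiff A B).card *
        newWeight (rows A) (cols A) (symmDiff A B) * schurWeight A) :=
        mul_le_mul_of_nonneg_left hm (by positivity)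
    _ = _ := by
        rw [mul_pow]
        ring

/-- The centred polynomials of the edge sets with at most `D` edges are nearly orthonormal. -/
lemma abs_integral_sq_sub_le [NeZero n] [NeZero d] {ε : ℝ} (hl : lam ≤ ε)
    (hlp : lam * ((Kn : ℝ) / n) ≤ ε * (√(n : ℝ))⁻¹)
    (hlq : lam * ((Kd : ℝ) / d) ≤ ε * (√(d : ℝ))⁻¹) {D : ℕ} (hD : 1 ≤ D)
    (hDε : 512 * (D : ℝ) ^ 2 * ε ≤ 1) (x : Finset (Fin n × Fin d) → ℝ)
    (hx : ∀ A, D < A.card → x A = 0) :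
    |∫ Y, (∑ A, x A * centredPoly ((Kn : ℝ) / n) ((Kd : ℝ) / d) lam A Y) ^ 2
      ∂(mixtureLaw n d Kn Kd lam) - ∑ A, x A ^ 2| ≤ 513 * (D : ℝ) ^ 2 * ε * ∑ A, x A ^ 2 := by
  have hε : 0 ≤ ε := h.nonneg.trans hl
  have hn : (0 : ℝ) < n := by exact_mod_cast Nat.pos_of_ne_zero (NeZero.ne n)
  have hd : (0 : ℝ) < d := by exact_mod_cast Nat.pos_of_ne_zero (NeZero.ne d)
  have hD1 : (1 : ℝ) ≤ D := by exact_mod_cast hD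
  set Q := fun A : Finset (Fin n × Fin d) =>
    centredPoly ((Kn : ℝ) / n) ((Kd : ℝ) / d) lam A with hQ
  set μ := mixtureLaw n d Kn Kd lam with hμ
  set Γ := fun A B : Finset (Fin n × Fin d) => ∫ Y, Q A Y * Q B Y ∂μ with hΓ
  have hw : ∀ A : Finset (Fin n × Fin d), 0 < schurWeight A := fun A => by
    unfold schurWeight
    positivity
  have hexp : ∫ Y, (∑ A, x A * Q A Y) ^ 2 ∂μ = ∑ A, ∑ B, x A * x B * Γ A B := by
    have hI : ∀ A B, Integrable (fun Y => x A * x B * (Q A Y * Q B Y)) μ := fun A B =>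
      (integrable_of_mem_polys h
        (mul_mem (centredPoly_mem_polys _ _ _ A) (centredPoly_mem_polys _ _ _ B))).const_mul _
    have : ∀ Y, (∑ A, x A * Q A Y) ^ 2 = ∑ A, ∑ B, x A * x B * (Q A Y * Q B Y) := by
      intro Y
      rw [sq, Finset.sum_mul_sum]
      exact Finset.sum_congr rfl fun A _ => Finset.sum_congr rfl fun B _ => by ring
    simp only [this]
    rw [integral_finsetSum _ fun A _ => integrable_finsetSum _ fun B _ => hI A B]
    simp_rw [integral_finsetSum _ fun B _ => hI _ B, integral_const_mul]
    rfl
  set s := Finset.univ.filter fun A : Finset (Fin n × Fin d) => A.card ≤ D with hs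
  have hxs : ∀ A ∉ s, x A = 0 := fun A hA => hx A (by simpa [hs] using hA)
  have hred : ∑ A, ∑ B, x A * x B * Γ A B = ∑ A ∈ s, ∑ B ∈ s, x A * x B * Γ A B := by
    rw [← Finset.sum_subset (Finset.subset_univ s) fun A _ hA =>
      Finset.sum_eq_zero fun B _ => by rw [hxs A hA]; ring]
    refine Finset.sum_congr rfl fun A _ => ?_
    rw [← Finset.sum_subset (Finset.subset_univ s) fun B _ hB => by rw [hxs B hB]; ring]
  have hred2 : ∑ A, x A ^ 2 = ∑ A ∈ s, x A ^ 2 := by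
    rw [← Finset.sum_subset (Finset.subset_univ s) fun A _ hA => by rw [hxs A hA]; ring]
  have hdiag : ∑ A ∈ s, ∑ B ∈ s, x A * x B * Γ A B - ∑ A ∈ s, x A ^ 2 =
      ∑ A ∈ s, ∑ B ∈ s, x A * x B * (Γ A B - if A = B then 1 else 0) := by
    rw [← Finset.sum_sub_distrib]
    refine Finset.sum_congr rfl fun A hA => ?_
    have : x A ^ 2 = ∑ B ∈ s, x A * x B * (if A = B then 1 else 0) := by
      simp [hA, sq]
    rw [this, ← Finset.sum_sub_distrib]
    exact Finset.sum_congr rfl fun B _ => by ring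
  rw [hexp, hred, hred2, hdiag]
  refine schur_test s _ schurWeight x _ (fun A _ B _ => ?_) (fun A _ => hw A) fun A hA => ?_
  · simp only [hΓ, mul_comm (Q A _), eq_comm (a := A)]
  have hAD : A.card ≤ D := (Finset.mem_filter.1 hA).2
  rw [← Finset.add_sum_erase _ _ hA]
  have hone : |Γ A A - if A = A then 1 else 0| ≤ (D : ℝ) ^ 2 * ε := by
    rw [if_pos rfl]
    refine (abs_integral_centredPoly_sq_sub_one_le h A).trans ?_
    have : (A.card : ℝ) ≤ (D : ℝ) ^ 2 := by
      have : (A.card : ℝ) ≤ D := by exact_mod_cast hAD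
      nlinarith
    exact mul_le_mul this hl h.nonneg (by positivity)
  have hoff : ∑ B ∈ s.erase A, |Γ A B - if A = B then 1 else 0| * schurWeight B ≤
      512 * (D : ℝ) ^ 2 * ε * schurWeight A := by
    -- `M = 3D`: at most `D` old rows or columns plus 2D edges of A∆B. Then 2·16·16 = 512, and the
    -- diagonal adds 1 to give 513.
    have hM : (((3 * D : ℕ) : ℝ) + 1) ^ 2 ≤ 16 * (D : ℝ) ^ 2 := by
      push_cast
      nlinarith
    have hM' : 16 * ε * (((3 * D : ℕ) : ℝ) + 1) ^ 2 ≤ 256 * (D : ℝ) ^ 2 * ε := by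
      nlinarith [mul_le_mul_of_nonneg_left hM hε]
    have hcount := sum_pow_mul_newWeight_le (y := 16 * ε) (by positivity) (rows A) (cols A)
      (3 * D) (2 * D) (by have := card_rows_le A; omega) (by have := card_cols_le A; omega)
      (by linarith)
    calc _ ≤ ∑ B ∈ s.erase A, (16 * ε) ^ (symmDiff A B).card *
          newWeight (rows A) (cols A) (symmDiff A B) * schurWeight A := by
          refine Finset.sum_le_sum fun B hB => ?_
          rw [if_neg (Finset.ne_of_mem_erase hB).symm, sub_zero]
          exact integral_mul_schurWeight_le h hl hlp hlq A B
      _ = (∑ F ∈ (s.erase A).image (symmDiff A), (16 * ε) ^ F.card *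
          newWeight (rows A) (cols A) F) * schurWeight A := by
          rw [Finset.sum_image fun B _ B' _ hBB => symmDiff_right_injective A hBB,
            Finset.sum_mul]
      _ ≤ (∑ F : Finset (Fin n × Fin d) with 1 ≤ F.card ∧ F.card ≤ 2 * D,
          (16 * ε) ^ F.card * newWeight (rows A) (cols A) F) * schurWeight A := by
          refine mul_le_mul_of_nonneg_right (Finset.sum_le_sum_of_subset_of_nonneg ?_
            fun F _ _ => mul_nonneg (by positivity) (newWeight_nonneg _ _ _)) (hw A).le
          intro F hF
          obtain ⟨B, hB, rfl⟩ := Finset.mem_image.1 hF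
          obtain ⟨hne, hBs⟩ := Finset.mem_erase.1 hB
          have hBD : B.card ≤ D := (Finset.mem_filter.1 hBs).2
          refine Finset.mem_filter.2 ⟨Finset.mem_univ _, Finset.card_pos.2 ?_, ?_⟩
          · rw [Finset.nonempty_iff_ne_empty]
            exact fun h0 => hne (symmDiff_eq_bot.1 h0).symm
          · have h1 : symmDiff A B ⊆ A ∪ B := symmDiff_le_sup
            have := Finset.card_le_card h1
            have := Finset.card_union_le A B
            omega
      _ ≤ _ := by
          refine mul_le_mul_of_nonneg_right (hcount.trans ?_) (hw A).le
          linarith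
  have := mul_le_mul_of_nonneg_right hone (hw A).le
  linarith

end NearOrthonormal

/-! ### Labelled templates as edge sets -/

namespace BiGraph

variable (G : BiGraph)

lemma toSimpleGraph_adj {v : Fin (G.r + 1)} {w : Fin G.s} (hvw : (v, w) ∈ G.E) :
    G.toSimpleGraph.Adj (Sum.inl v) (Sum.inr w) := by
  simp [toSimpleGraph, hvw]

lemma exists_edge_of_adj {x y : Fin (G.r + 1) ⊕ Fin G.s} (hxy : G.toSimpleGraph.Adj x y) :
    ∃ e ∈ G.E, (x = Sum.inl e.1 ∧ y = Sum.inr e.2) ∨ (y = Sum.inl e.1 ∧ x = Sum.inr e.2) := by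
  rw [toSimpleGraph, SimpleGraph.fromRel_adj] at hxy
  rcases hxy.2 with ⟨v, w, h1, h2, h3⟩ | ⟨v, w, h1, h2, h3⟩
  · exact ⟨_, h3, Or.inl ⟨h1, h2⟩⟩
  · exact ⟨_, h3, Or.inr ⟨h1, h2⟩⟩

lemma mem_componentEdges {c : G.toSimpleGraph.ConnectedComponent}
    {e : Fin (G.r + 1) × Fin G.s} :
    e ∈ G.componentEdges c ↔ e ∈ G.E ∧ G.edgeComponent e = c := by
  simp [componentEdges]

lemma edgeComponent_eq_of_touch {e f : Fin (G.r + 1) × Fin G.s} (he : e ∈ G.E) (hf : f ∈ G.E)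
    (hef : Touch e f) : G.edgeComponent e = G.edgeComponent f := by
  rcases hef with h | h
  · rw [edgeComponent, h, edgeComponent]
  · refine SimpleGraph.ConnectedComponent.sound ?_
    have h1 := (G.toSimpleGraph_adj he).reachable
    have h2 := (G.toSimpleGraph_adj hf).reachable
    rw [← h] at h2
    exact h1.trans h2.symm

/-- Along a path the invariant is that every edge at the current node lies in `U`. This links graph
reachability to components defined by closed sets. -/
lemma mem_of_reachable {U : Set (Fin (G.r + 1) × Fin G.s)} (hU : ClosedIn G.E U)
    {e : Fin (G.r + 1) × Fin G.s} (he : e ∈ U) {x : Fin (G.r + 1) ⊕ Fin G.s}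
    (hx : G.toSimpleGraph.Reachable (Sum.inl e.1) x) :
    ∀ f ∈ G.E, (x = Sum.inl f.1 ∨ x = Sum.inr f.2) → f ∈ U := by
  rw [SimpleGraph.reachable_iff_reflTransGen] at hx
  induction hx with
  | refl =>
    rintro f hf (h | h)
    · exact hU e he f hf (Or.inl (Sum.inl_injective h))
    · exact absurd h (by simp)
  | tail _ hxy ih =>
    intro f hf hyf
    obtain ⟨a, ha, ⟨h1, h2⟩ | ⟨h1, h2⟩⟩ := G.exists_edge_of_adj hxy
    · have haU := ih a ha (Or.inl h1)
      rcases hyf with h | h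
      · exact absurd (h2.symm.trans h) (by simp)
      · exact hU a haU f hf (Or.inr (Sum.inr_injective (h2.symm.trans h)))
    · have haU := ih a ha (Or.inr h2)
      rcases hyf with h | h
      · exact hU a haU f hf (Or.inl (Sum.inl_injective (h1.symm.trans h)))
      · exact absurd (h1.symm.trans h) (by simp)

lemma componentEdges_edgeComponent {e : Fin (G.r + 1) × Fin G.s} (he : e ∈ G.E) :
    G.componentEdges (G.edgeComponent e) = edgeClass G.E e := by
  ext f
  rw [mem_componentEdges, mem_edgeClass]
  refine and_congr_right fun hf => ⟨fun h U hU heU => ?_, fun h => ?_⟩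
  · exact G.mem_of_reachable hU heU (SimpleGraph.ConnectedComponent.exact h).symm f hf
      (Or.inl rfl)
  · refine (h {f | f ∈ G.E ∧ G.edgeComponent f = G.edgeComponent e} ?_ ⟨he, rfl⟩).2
    rintro x ⟨hx, hxe⟩ y hy hxy
    exact ⟨hy, (G.edgeComponent_eq_of_touch hx hy hxy).symm.trans hxe⟩

variable {n d : ℕ}

lemma touch_map_iff {ι κ ι' κ' : Type*} (σ : ι ↪ ι') (τ : κ ↪ κ') {e f : ι × κ} :
    Touch (Prod.map σ τ e) (Prod.map σ τ f) ↔ Touch e f := by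
  simp [Touch]

/-- Injective labellings preserve and reflect touching, so the image of a class and preimages of
closed sets are closed. -/
lemma edgeClass_image {ι κ ι' κ' : Type*} [DecidableEq ι'] [DecidableEq κ'] (σ : ι ↪ ι')
    (τ : κ ↪ κ') (A : Finset (ι × κ)) {e : ι × κ} (he : e ∈ A) :
    edgeClass (A.image (Prod.map σ τ)) (Prod.map σ τ e) =
      (edgeClass A e).image (Prod.map σ τ) := by
  classical
  apply Finset.Subset.antisymm
  · intro x hx
    refine (mem_edgeClass.1 hx).2 (((edgeClass A e).image (Prod.map σ τ) : Finset _) : Set _) ?_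
      (Finset.mem_coe.2 (Finset.mem_image_of_mem _ (mem_edgeClass_self he)))
    intro y hy z hz hyz
    obtain ⟨a, ha, rfl⟩ := Finset.mem_image.1 (Finset.mem_coe.1 hy)
    obtain ⟨b, hb, rfl⟩ := Finset.mem_image.1 hz
    exact Finset.mem_coe.2 (Finset.mem_image_of_mem _
      (closedIn_edgeClass A e a ha b hb ((touch_map_iff σ τ).1 hyz)))
  · intro x hx
    obtain ⟨f, hf, rfl⟩ := Finset.mem_image.1 hx
    obtain ⟨hfA, hf⟩ := mem_edgeClass.1 hf
    refine mem_edgeClass.2 ⟨Finset.mem_image_of_mem _ hfA, fun U hU heU => ?_⟩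
    exact hf (Prod.map σ τ ⁻¹' U) (fun a ha b hb hab => hU _ ha _
      (Finset.mem_image_of_mem _ hb) ((touch_map_iff σ τ).2 hab)) heU

/-! ### Copies of a template. -/

/-- The edge set of the copy of `G` given by a pair of labellings. -/
def copyEdges (φ : (Fin (G.r + 1) ↪ Fin n) × (Fin G.s ↪ Fin d)) : Finset (Fin n × Fin d) :=
  G.E.image (Prod.map φ.1 φ.2)

lemma card_copyEdges (φ : (Fin (G.r + 1) ↪ Fin n) × (Fin G.s ↪ Fin d)) :
    (G.copyEdges φ).card = G.E.card :=
  Finset.card_image_of_injective _ (φ.1.injective.prodMap φ.2.injective)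

lemma mem_copyEdges {φ : (Fin (G.r + 1) ↪ Fin n) × (Fin G.s ↪ Fin d)} {v : Fin (G.r + 1)}
    {w : Fin G.s} : (φ.1 v, φ.2 w) ∈ G.copyEdges φ ↔ (v, w) ∈ G.E := by
  constructor
  · intro h
    obtain ⟨e, he, hEq⟩ := Finset.mem_image.1 h
    rwa [← φ.1.injective.prodMap φ.2.injective (a₁ := e) (a₂ := (v, w)) hEq]
  · exact fun h => Finset.mem_image.2 ⟨_, h, rfl⟩

/-- The labelled polynomial only depends on the edge set of the copy. -/
lemma labelledPoly_eq_centredPoly {Kn Kd : ℕ} {lam : ℝ} (h : Admissible n d Kn Kd lam)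
    (φ : (Fin (G.r + 1) ↪ Fin n) × (Fin G.s ↪ Fin d)) (Y : Fin n × Fin d → ℝ) :
    G.labelledPoly Kn Kd lam φ.1 φ.2 Y =
      centredPoly ((Kn : ℝ) / n) ((Kd : ℝ) / d) lam (G.copyEdges φ) Y := by
  classical
  have hinj : Function.Injective (Prod.map φ.1 φ.2) := φ.1.injective.prodMap φ.2.injective
  have hmono : ∀ (c : G.toSimpleGraph.ConnectedComponent) (Z : Fin n × Fin d → ℝ),
      G.componentMonomial c φ.1 φ.2 Z =
        mono ((G.componentEdges c).image (Prod.map φ.1 φ.2)) Z := by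
    intro c Z
    rw [mono, Finset.prod_image fun a _ b _ hab => hinj hab]
    rfl
  have hcomp : ∀ e ∈ G.E, (G.componentEdges (G.edgeComponent e)).image (Prod.map φ.1 φ.2) =
      edgeClass (G.copyEdges φ) (Prod.map φ.1 φ.2 e) := fun e he => by
    rw [G.componentEdges_edgeComponent he, copyEdges, edgeClass_image φ.1 φ.2 G.E he]
  unfold labelledPoly centredPoly centredProd
  refine Finset.prod_bij (fun c _ => (G.componentEdges c).image (Prod.map φ.1 φ.2)) ?_ ?_ ?_ ?_
  · intro c hc
    obtain ⟨e, he, rfl⟩ := Finset.mem_image.1 hc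
    rw [hcomp e he]
    exact edgeClass_mem_comps (Finset.mem_image_of_mem _ he)
  · intro c hc c' hc' hEq
    obtain ⟨e, he, rfl⟩ := Finset.mem_image.1 hc
    have h1 := Finset.image_injective hinj hEq
    have h2 : e ∈ G.componentEdges c' := h1 ▸ G.mem_componentEdges.2 ⟨he, rfl⟩
    exact (G.mem_componentEdges.1 h2).2
  · intro C hC
    obtain ⟨x, hx, rfl⟩ := mem_comps.1 hC
    obtain ⟨e, he, rfl⟩ := Finset.mem_image.1 hx
    exact ⟨G.edgeComponent e, Finset.mem_image_of_mem _ he, hcomp e he⟩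
  · intro c _
    simp only [hmono]
    rw [integral_mono h]

/-! ### Counting labellings -/

/-- The pairs of labellings that send the distinguished node to the first row. -/
def labellings (n d : ℕ) [NeZero n] : Finset ((Fin (G.r + 1) ↪ Fin n) × (Fin G.s ↪ Fin d)) :=
  (Finset.univ.filter fun σ : Fin (G.r + 1) ↪ Fin n => σ 0 = 0) ×ˢ Finset.univ

variable [NeZero n]

lemma mem_labellings {φ : (Fin (G.r + 1) ↪ Fin n) × (Fin G.s ↪ Fin d)} :
    φ ∈ G.labellings n d ↔ φ.1 0 = 0 := by
  simp [labellings]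

lemma templatePoly_eq_sum {Kn Kd : ℕ} {lam : ℝ} (h : Admissible n d Kn Kd lam)
    (Y : Fin n × Fin d → ℝ) :
    G.templatePoly Kn Kd lam Y = ∑ φ ∈ G.labellings n d,
      centredPoly ((Kn : ℝ) / n) ((Kd : ℝ) / d) lam (G.copyEdges φ) Y := by
  simp only [← G.labelledPoly_eq_centredPoly h]
  rw [labellings, Finset.sum_product]
  rfl

variable {G} {H : BiGraph} {D : ℕ}

/-- An isolated root is invisible in the edge set, but its image is pinned to row 0, so the edge set
still determines all labelled rows. -/
lemma IsTemplate.mem_range_fst (hG : G.IsTemplate D)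
    {φ : (Fin (G.r + 1) ↪ Fin n) × (Fin G.s ↪ Fin d)} (hφ : φ.1 0 = 0) (i : Fin n) :
    i ∈ Set.range φ.1 ↔ i = 0 ∨ i ∈ rows (G.copyEdges φ) := by
  constructor
  · rintro ⟨v, rfl⟩
    by_cases hv : v = 0
    · exact Or.inl (hv ▸ hφ)
    · obtain ⟨w, hw⟩ := hG.2.2.1 v hv
      exact Or.inr (fst_mem_rows (G.mem_copyEdges.2 hw))
  · rintro (rfl | hi)
    · exact ⟨0, hφ⟩
    · obtain ⟨k, hk⟩ := mem_rows.1 hi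
      obtain ⟨e, _, hEq⟩ := Finset.mem_image.1 hk
      exact ⟨e.1, congrArg Prod.fst hEq⟩

lemma IsTemplate.mem_range_snd (hG : G.IsTemplate D)
    (φ : (Fin (G.r + 1) ↪ Fin n) × (Fin G.s ↪ Fin d)) (k : Fin d) :
    k ∈ Set.range φ.2 ↔ k ∈ cols (G.copyEdges φ) := by
  constructor
  · rintro ⟨w, rfl⟩
    obtain ⟨v, hv⟩ := hG.2.2.2 w
    exact snd_mem_cols (G.mem_copyEdges.2 hv)
  · intro hk
    obtain ⟨i, hi⟩ := mem_cols.1 hk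
    obtain ⟨e, _, hEq⟩ := Finset.mem_image.1 hi
    exact ⟨e.2, congrArg Prod.snd hEq⟩

lemma exists_equiv_of_range_eq {α β γ : Type*} (f : α ↪ γ) (g : β ↪ γ)
    (hfg : Set.range f = Set.range g) : ∃ e : α ≃ β, ∀ a, g (e a) = f a := by
  refine ⟨(Equiv.ofInjective f f.injective).trans ((Equiv.setCongr hfg).trans
    (Equiv.ofInjective g g.injective).symm), fun a => ?_⟩
  simp only [Equiv.trans_apply]
  exact Equiv.apply_ofInjective_symm g.injective _

/-- Two labelled templates with the same edge set are equivalent, through the labellings. -/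
lemma exists_equiv_of_copyEdges_eq (hG : G.IsTemplate D) (hH : H.IsTemplate D)
    {φ : (Fin (G.r + 1) ↪ Fin n) × (Fin G.s ↪ Fin d)}
    {ψ : (Fin (H.r + 1) ↪ Fin n) × (Fin H.s ↪ Fin d)} (hφ : φ.1 0 = 0) (hψ : ψ.1 0 = 0)
    (hEq : G.copyEdges φ = H.copyEdges ψ) :
    ∃ (f : Fin (G.r + 1) ≃ Fin (H.r + 1)) (g : Fin G.s ≃ Fin H.s),
      (f 0 = 0 ∧ ∀ v w, (v, w) ∈ G.E ↔ (f v, g w) ∈ H.E) ∧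
        (∀ v, ψ.1 (f v) = φ.1 v) ∧ ∀ w, ψ.2 (g w) = φ.2 w := by
  obtain ⟨f, hf⟩ := exists_equiv_of_range_eq φ.1 ψ.1 (by
    ext i
    rw [hG.mem_range_fst hφ, hH.mem_range_fst hψ, hEq])
  obtain ⟨g, hg⟩ := exists_equiv_of_range_eq φ.2 ψ.2 (by
    ext k
    rw [hG.mem_range_snd, hH.mem_range_snd, hEq])
  refine ⟨f, g, ⟨ψ.1.injective ?_, fun v w => ?_⟩, hf, hg⟩
  · rw [hf, hφ, hψ]
  · rw [← G.mem_copyEdges (φ := φ), ← H.mem_copyEdges (φ := ψ), hf, hg, hEq]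

/-- Each copy of a template comes from as many labellings as the template has automorphisms. -/
lemma IsTemplate.card_fiber (hG : G.IsTemplate D)
    {φ : (Fin (G.r + 1) ↪ Fin n) × (Fin G.s ↪ Fin d)} (hφ : φ ∈ G.labellings n d) :
    ((G.labellings n d).filter fun ψ => G.copyEdges ψ = G.copyEdges φ).card = G.autCard := by
  have hφ0 := G.mem_labellings.1 hφ
  rw [autCard, ← Fintype.card_coe, ← Nat.card_eq_fintype_card]
  symm
  -- Automorphisms act on labellings by precomposition, freely by injectivity and transitively on a
  -- fibre by `exists_equiv_of_copyEdges_eq`.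
  refine Nat.card_eq_of_bijective (fun a => ⟨(a.1.1.toEmbedding.trans φ.1,
    a.1.2.toEmbedding.trans φ.2), ?_⟩) ⟨?_, ?_⟩
  · obtain ⟨⟨f, g⟩, hf0, hE⟩ := a
    refine Finset.mem_filter.2 ⟨G.mem_labellings.2 ?_, ?_⟩
    · simpa [hφ0] using congrArg φ.1 hf0
    · ext x
      constructor
      · intro hx
        obtain ⟨e, he, rfl⟩ := Finset.mem_image.1 hx
        exact G.mem_copyEdges.2 ((hE e.1 e.2).1 he)
      · intro hx
        obtain ⟨e, he, rfl⟩ := Finset.mem_image.1 hx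
        refine Finset.mem_image.2 ⟨(f.symm e.1, g.symm e.2), (hE _ _).2 (by simpa using he), ?_⟩
        simp [Prod.map]
  · rintro ⟨⟨f, g⟩, hfg⟩ ⟨⟨f', g'⟩, hfg'⟩ hEq
    simp only [Subtype.mk.injEq, Prod.mk.injEq] at hEq ⊢
    constructor
    · ext1 v
      exact φ.1.injective (DFunLike.congr_fun hEq.1 v)
    · ext1 w
      exact φ.2.injective (DFunLike.congr_fun hEq.2 w)
  · rintro ⟨ψ, hψ⟩
    obtain ⟨hψ0, hψE⟩ := Finset.mem_filter.1 hψ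
    obtain ⟨f, g, hfg, hf, hg⟩ :=
      exists_equiv_of_copyEdges_eq hG hG (G.mem_labellings.1 hψ0) hφ0 hψE
    refine ⟨⟨(f, g), hfg⟩, Subtype.ext (Prod.ext ?_ ?_)⟩
    · ext1 v
      exact hf v
    · ext1 w
      exact hg w

lemma card_embeddings_zero (m r : ℕ) [NeZero m] :
    (Finset.univ.filter fun σ : Fin (r + 1) ↪ Fin m => σ 0 = 0).card =
      (m - 1).descFactorial r := by
  have hcard : Fintype.card {i : Fin m // i ≠ 0} = m - 1 := by
    rw [Fintype.card_subtype_compl]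
    simp
  rw [← hcard]
  conv_rhs => rw [← Fintype.card_fin r]
  rw [← Fintype.card_embedding_eq, ← Fintype.card_subtype]
  refine Fintype.card_congr
    { toFun := fun σ => ⟨fun v => ⟨σ.1 v.succ, fun h0 => ?_⟩, fun a b hab => ?_⟩
      invFun := fun ρ => ⟨⟨Fin.cons 0 fun v => (ρ v).1, ?_⟩, rfl⟩
      left_inv := fun σ => ?_
      right_inv := fun ρ => ?_ }
  · exact Fin.succ_ne_zero v (σ.1.injective (h0.trans σ.2.symm))
  · exact Fin.succ_injective _ (σ.1.injective (Subtype.ext_iff.1 hab))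
  · refine Fin.cons_injective_iff.2 ⟨?_, Subtype.val_injective.comp ρ.injective⟩
    rintro ⟨v, hv⟩
    exact (ρ v).2 hv
  · ext v
    refine Fin.cases ?_ (fun v => ?_) v
    · simp [σ.2]
    · rfl
  · ext v
    simp

/-- The normalisation is the number of labellings times the number of automorphisms. -/
lemma normalization_eq (hr : G.r + 1 ≤ n) (hs : G.s ≤ d) :
    G.normalization n d = (G.labellings n d).card * G.autCard := by
  rw [normalization, labellings, Finset.card_product, card_embeddings_zero, Finset.card_univ,
    Fintype.card_embedding_eq, Fintype.card_fin, Fintype.card_fin]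
  have h1 : ((n - 1).factorial : ℝ) / ((n - (G.r + 1)).factorial : ℝ) =
      ((n - 1).descFactorial G.r : ℕ) := by
    rw [div_eq_iff (by positivity)]
    have := Nat.factorial_mul_descFactorial (n := n - 1) (k := G.r) (by omega)
    rw [show n - 1 - G.r = n - (G.r + 1) by omega] at this
    rw [← this]
    push_cast
    ring
  have h2 : (d.factorial : ℝ) / ((d - G.s).factorial : ℝ) = (d.descFactorial G.s : ℕ) := by
    rw [div_eq_iff (by positivity), ← Nat.factorial_mul_descFactorial hs]
    push_cast
    ring
  rw [h1, h2]
  push_cast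
  ring

lemma IsTemplate.r_le (hG : G.IsTemplate D) : G.r ≤ D := by
  have h : (Finset.univ.filter fun v : Fin (G.r + 1) => v ≠ 0) ⊆ rows G.E := by
    intro v hv
    obtain ⟨w, hw⟩ := hG.2.2.1 v (Finset.mem_filter.1 hv).2
    exact mem_rows.2 ⟨w, hw⟩
  have h1 := Finset.card_le_card h
  have h2 := card_rows_le G.E
  have h3 := hG.2.1
  have h4 : (Finset.univ.filter fun v : Fin (G.r + 1) => v ≠ 0).card = G.r := by
    rw [Finset.filter_ne', Finset.card_erase_of_mem (Finset.mem_univ _)]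
    simp
  omega

lemma IsTemplate.s_le (hG : G.IsTemplate D) : G.s ≤ D := by
  have h : (Finset.univ : Finset (Fin G.s)) ⊆ cols G.E := by
    intro w _
    obtain ⟨v, hv⟩ := hG.2.2.2 w
    exact mem_cols.2 ⟨v, hv⟩
  have h1 := Finset.card_le_card h
  have h2 := card_cols_le G.E
  have h3 := hG.2.1
  simp only [Finset.card_univ, Fintype.card_fin] at h1
  omega

end BiGraph

/-! ### Expansion of template combinations over edge sets -/

namespace BiGraph

variable {n d : ℕ} [NeZero n] {D : ℕ}

/-- The number of labellings of `G` whose copy has the edge set `A`. -/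
def copyCount (G : BiGraph) (A : Finset (Fin n × Fin d)) : ℕ :=
  ((G.labellings n d).filter fun φ => G.copyEdges φ = A).card

/-- The coefficient of the edge set `A` in a linear combination of the templates in `𝒢`. -/
def edgeCoeff (𝒢 : Finset BiGraph) (α₀ : ℝ) (α : BiGraph → ℝ) (A : Finset (Fin n × Fin d)) : ℝ :=
  (if A = ∅ then α₀ else 0) + ∑ G ∈ 𝒢, α G / √(G.normalization n d) * G.copyCount A

lemma exists_labelling_of_copyCount_ne_zero {G : BiGraph} {A : Finset (Fin n × Fin d)}
    (h : G.copyCount A ≠ 0) : ∃ φ ∈ G.labellings n d, G.copyEdges φ = A := by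
  obtain ⟨φ, hφ⟩ := Finset.card_pos.1 (Nat.pos_of_ne_zero h)
  exact ⟨φ, (Finset.mem_filter.1 hφ).1, (Finset.mem_filter.1 hφ).2⟩

lemma IsTemplate.card_of_copyCount_ne_zero {G : BiGraph} (hG : G.IsTemplate D)
    {A : Finset (Fin n × Fin d)} (h : G.copyCount A ≠ 0) : 1 ≤ A.card ∧ A.card ≤ D := by
  obtain ⟨φ, _, rfl⟩ := exists_labelling_of_copyCount_ne_zero h
  rw [card_copyEdges]
  exact ⟨hG.1, hG.2.1⟩

lemma edgeCoeff_eq_zero {𝒢 : Finset BiGraph} (h𝒢 : ∀ G ∈ 𝒢, G.IsTemplate D) (α₀ : ℝ)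
    (α : BiGraph → ℝ) (A : Finset (Fin n × Fin d)) (hA : D < A.card) :
    edgeCoeff 𝒢 α₀ α A = 0 := by
  have hA0 : A ≠ ∅ := by
    rintro rfl
    simp at hA
  rw [edgeCoeff, if_neg hA0, zero_add]
  refine Finset.sum_eq_zero fun G hG => ?_
  have : G.copyCount A = 0 := by
    by_contra hne
    have := ((h𝒢 G hG).card_of_copyCount_ne_zero hne).2
    omega
  simp [this]

lemma sum_copyCount_mul (G : BiGraph) (F : Finset (Fin n × Fin d) → ℝ) :
    ∑ A, (G.copyCount A : ℝ) * F A = ∑ φ ∈ G.labellings n d, F (G.copyEdges φ) := by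
  rw [← Finset.sum_fiberwise (G.labellings n d) G.copyEdges]
  refine Finset.sum_congr rfl fun A _ => ?_
  rw [Finset.sum_congr rfl fun φ hφ => by rw [(Finset.mem_filter.1 hφ).2], Finset.sum_const,
    nsmul_eq_mul]
  rfl

/-- Labellings are grouped by edge set; the constant is carried by the empty set, whose centred
polynomial is the empty product 1. -/
lemma add_sum_Psi_eq {Kn Kd : ℕ} {lam : ℝ} (h : Admissible n d Kn Kd lam)
    (𝒢 : Finset BiGraph) (α₀ : ℝ) (α : BiGraph → ℝ) (Y : Fin n × Fin d → ℝ) :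
    α₀ + ∑ G ∈ 𝒢, α G * G.Psi Kn Kd lam Y =
      ∑ A, edgeCoeff 𝒢 α₀ α A * centredPoly ((Kn : ℝ) / n) ((Kd : ℝ) / d) lam A Y := by
  simp only [edgeCoeff, add_mul, Finset.sum_add_distrib, ite_mul, zero_mul, Finset.sum_ite_eq',
    Finset.mem_univ, if_true, Finset.sum_mul]
  congr 1
  · simp [centredPoly, centredProd, comps]
  · rw [Finset.sum_comm]
    refine Finset.sum_congr rfl fun G _ => ?_
    simp only [mul_assoc]
    rw [← Finset.mul_sum, G.sum_copyCount_mul, ← G.templatePoly_eq_sum h, Psi]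
    ring

/-- One factor `copyCount` turns the sum into one over labellings; the other is then constantly
`autCard`. This explains the normalisation. -/
lemma IsTemplate.sum_copyCount_sq {G : BiGraph} (hG : G.IsTemplate D) :
    ∑ A : Finset (Fin n × Fin d), (G.copyCount A : ℝ) ^ 2 =
      (G.labellings n d).card * G.autCard := by
  simp only [sq]
  rw [G.sum_copyCount_mul, Finset.sum_congr rfl fun φ hφ => by
    rw [copyCount, hG.card_fiber hφ], Finset.sum_const, nsmul_eq_mul]

lemma normalization_pos (G : BiGraph) (n d : ℕ) : 0 < G.normalization n d := by
  unfold normalization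
  have : 0 < G.autCard := by
    unfold autCard
    have : Nonempty {f : Equiv.Perm (Fin (G.r + 1)) × Equiv.Perm (Fin G.s) //
        f.1 0 = 0 ∧ ∀ v w, (v, w) ∈ G.E ↔ (f.1 v, f.2 w) ∈ G.E} :=
      ⟨⟨(1, 1), by simp⟩⟩
    exact Nat.card_pos
  positivity

/-- Cross terms vanish because a shared copy would make two templates equivalent, and the empty set
is a copy of no template. -/
lemma sum_edgeCoeff_sq {𝒢 : Finset BiGraph} (h𝒢 : ∀ G ∈ 𝒢, G.IsTemplate D)
    (hne : ∀ G ∈ 𝒢, ∀ H ∈ 𝒢, G.Equivalent H → G = H) (hn : D + 1 ≤ n) (hd : D ≤ d)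
    (α₀ : ℝ) (α : BiGraph → ℝ) :
    ∑ A : Finset (Fin n × Fin d), edgeCoeff 𝒢 α₀ α A ^ 2 = α₀ ^ 2 + ∑ G ∈ 𝒢, α G ^ 2 := by
  have hsq : ∀ A : Finset (Fin n × Fin d), edgeCoeff 𝒢 α₀ α A ^ 2 =
      (if A = ∅ then α₀ ^ 2 else 0) +
        ∑ G ∈ 𝒢, (α G / √(G.normalization n d)) ^ 2 * (G.copyCount A : ℝ) ^ 2 := by
    intro A
    by_cases hA : A = ∅
    · have h0 : ∀ G ∈ 𝒢, G.copyCount A = 0 := fun G hG => by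
        by_contra hcon
        have := ((h𝒢 G hG).card_of_copyCount_ne_zero hcon).1
        simp [hA] at this
      rw [edgeCoeff, if_pos hA, if_pos hA, Finset.sum_eq_zero fun G hG => by simp [h0 G hG],
        Finset.sum_eq_zero fun G hG => by simp [h0 G hG]]
      ring
    · rw [edgeCoeff, if_neg hA, if_neg hA, zero_add, zero_add, sq, Finset.sum_mul_sum]
      refine Finset.sum_congr rfl fun G hG => ?_
      rw [Finset.sum_eq_single_of_mem G hG]
      · ring
      · intro H hH hHG
        have : G.copyCount A = 0 ∨ H.copyCount A = 0 := by
          by_contra! hcon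
          obtain ⟨φ, hφ, hφA⟩ := exists_labelling_of_copyCount_ne_zero hcon.1
          obtain ⟨ψ, hψ, hψA⟩ := exists_labelling_of_copyCount_ne_zero hcon.2
          obtain ⟨f, g, hfg, _⟩ := exists_equiv_of_copyEdges_eq (h𝒢 G hG) (h𝒢 H hH)
            (G.mem_labellings.1 hφ) (H.mem_labellings.1 hψ) (hφA.trans hψA.symm)
          exact hHG (hne G hG H hH ⟨f, g, hfg⟩).symm
        rcases this with h0 | h0 <;> simp [h0]
  simp only [hsq, Finset.sum_add_distrib, Finset.sum_ite_eq', Finset.mem_univ, if_true]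
  rw [Finset.sum_comm]
  congr 1
  refine Finset.sum_congr rfl fun G hG => ?_
  have hr := (h𝒢 G hG).r_le
  have hs := (h𝒢 G hG).s_le
  have hpos : 0 < G.normalization n d := G.normalization_pos n d
  rw [← Finset.mul_sum, (h𝒢 G hG).sum_copyCount_sq, ← normalization_eq (by omega) (by omega),
    div_pow, Real.sq_sqrt hpos.le]
  field_simp

end BiGraph

/-! ### Numerical bounds -/

/-- Since 513 ≤ 2¹⁰ ≤ D¹⁰, it suffices that 12 - 8cs ≤ -cs/4, which holds for cs ≥ 2. -/
lemma mul_sq_mul_rpow_le {D : ℕ} (hD : 2 ≤ D) {cs : ℝ} (hcs : 2 ≤ cs) :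
    513 * (D : ℝ) ^ 2 * (D : ℝ) ^ (-(8 * cs)) ≤ (D : ℝ) ^ (-(cs / 4)) := by
  have hD2 : (2 : ℝ) ≤ D := by exact_mod_cast hD
  have hD0 : (0 : ℝ) < D := by linarith
  have h1 : (513 : ℝ) ≤ (D : ℝ) ^ 10 := by
    calc (513 : ℝ) ≤ 2 ^ 10 := by norm_num
      _ ≤ (D : ℝ) ^ 10 := by gcongr
  calc 513 * (D : ℝ) ^ 2 * (D : ℝ) ^ (-(8 * cs))
      ≤ (D : ℝ) ^ 10 * (D : ℝ) ^ 2 * (D : ℝ) ^ (-(8 * cs)) := by gcongr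
    _ = (D : ℝ) ^ ((12 : ℝ) + -(8 * cs)) := by
        rw [Real.rpow_add hD0, ← pow_add, ← Real.rpow_natCast]
        norm_num
    _ ≤ (D : ℝ) ^ (-(cs / 4)) :=
        Real.rpow_le_rpow_of_exponent_le (by linarith) (by linarith)

lemma mul_div_le_of_mul_div_sqrt_le {lam ε : ℝ} {K m : ℕ}
    (h : lam * K / √(m : ℝ) ≤ ε) : lam * ((K : ℝ) / m) ≤ ε * (√(m : ℝ))⁻¹ := by
  have h1 := mul_le_mul_of_nonneg_right h (inv_nonneg.2 (Real.sqrt_nonneg (m : ℝ)))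
  have h2 : lam * K / √(m : ℝ) * (√(m : ℝ))⁻¹ = lam * ((K : ℝ) / m) := by
    rw [← div_eq_mul_inv, div_div, Real.mul_self_sqrt (Nat.cast_nonneg m), mul_div_assoc]
  rwa [h2] at h1

lemma le_of_div_le {K m : ℕ} (hK : 1 ≤ K) (hKm : K ≤ m) {a ε : ℝ} (ha : 0 ≤ a)
    (haε : a * ε ≤ 1) (h : (K : ℝ) / m ≤ ε) : a ≤ m := by
  have hm : (0 : ℝ) < m := by exact_mod_cast hK.trans hKm
  have hK' : (1 : ℝ) ≤ K := by exact_mod_cast hK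
  have h1 : 1 ≤ ε * m := hK'.trans ((div_le_iff₀ hm).1 h)
  nlinarith [mul_le_mul_of_nonneg_left h1 ha, mul_le_mul_of_nonneg_right haε hm.le]

end SubmatrixLD

end

/-! ### Choice of constants and conclusion. -/

theorem mainTheorem2 :
    ∃ c₀ : ℝ, 0 < c₀ ∧ ∀ cs : ℝ, c₀ ≤ cs →
      ∀ (n d : ℕ) [NeZero n] (D Kn Kd : ℕ) (lam : ℝ),
        2 ≤ D → 1 ≤ Kn → Kn ≤ n → 1 ≤ Kd → Kd ≤ d → 0 ≤ lam → lam ≤ 1 →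
        ((Kn : ℝ) / n) ⊔ ((Kd : ℝ) / d) ⊔ (lam * Kn / Real.sqrt n) ⊔
            (lam * Kd / Real.sqrt d) ⊔ lam ≤ (D : ℝ) ^ (-(8 * cs)) →
        ∀ 𝒢 : Finset SubmatrixLD.BiGraph, SubmatrixLD.BiGraph.IsTemplateCollection D 𝒢 →
        ∀ (α₀ : ℝ) (α : SubmatrixLD.BiGraph → ℝ),
          (1 - (D : ℝ) ^ (-(cs / 4))) * (α₀ ^ 2 + ∑ G ∈ 𝒢, α G ^ 2) ≤
              ∫ Y, (α₀ + ∑ G ∈ 𝒢, α G * G.Psi Kn Kd lam Y) ^ 2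
                ∂(SubmatrixLD.mixtureLaw n d Kn Kd lam) ∧
            ∫ Y, (α₀ + ∑ G ∈ 𝒢, α G * G.Psi Kn Kd lam Y) ^ 2
                ∂(SubmatrixLD.mixtureLaw n d Kn Kd lam) ≤
              (1 + (D : ℝ) ^ (-(cs / 4))) * (α₀ ^ 2 + ∑ G ∈ 𝒢, α G ^ 2) := by
  refine ⟨2, by norm_num, ?_⟩
  intro cs hcs n d _ D Kn Kd lam hD hKn hKnn hKd hKdd hl0 hl1 hmax 𝒢 h𝒢 α₀ α
  simp only [sup_le_iff] at hmax
  obtain ⟨⟨⟨⟨hp, hq⟩, hlp⟩, hlq⟩, hl⟩ := hmax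
  have hD2 : (2 : ℝ) ≤ D := by exact_mod_cast hD
  have hbound := SubmatrixLD.mul_sq_mul_rpow_le hD hcs
  have hle1 : (D : ℝ) ^ (-(cs / 4)) ≤ 1 :=
    Real.rpow_le_one_of_one_le_of_nonpos (by linarith) (by linarith)
  set ε := (D : ℝ) ^ (-(8 * cs))
  have hε : 0 ≤ ε := hl0.trans hl
  have hsize : ∀ m : ℕ, 513 * (D : ℝ) ^ 2 ≤ m → D + 1 ≤ m := fun m hm => by
    have : ((D + 1 : ℕ) : ℝ) ≤ m := by
      push_cast
      nlinarith
    exact_mod_cast this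
  -- As 1/n ≤ Kn/n ≤ ε and 513D²ε ≤ 1, the dimension is at least 513D². Hence every template fits
  -- and the subtractions in `normalization` are not truncated; the same holds for `d`.
  have hn := hsize n (SubmatrixLD.le_of_div_le hKn hKnn (by positivity) (by linarith) hp)
  have hd := hsize d (SubmatrixLD.le_of_div_le hKd hKdd (by positivity) (by linarith) hq)
  have : NeZero d := ⟨by omega⟩
  have hadm : SubmatrixLD.Admissible n d Kn Kd lam := ⟨hKnn, hKdd, hl0, hl1⟩
  have key := SubmatrixLD.abs_integral_sq_sub_le hadm hl
    (SubmatrixLD.mul_div_le_of_mul_div_sqrt_le hlp)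
    (SubmatrixLD.mul_div_le_of_mul_div_sqrt_le hlq) (D := D) (by omega)
    (by nlinarith [mul_nonneg (sq_nonneg (D : ℝ)) hε])
    (SubmatrixLD.BiGraph.edgeCoeff 𝒢 α₀ α)
    (SubmatrixLD.BiGraph.edgeCoeff_eq_zero h𝒢.1 α₀ α)
  simp only [← SubmatrixLD.BiGraph.add_sum_Psi_eq hadm] at key
  rw [SubmatrixLD.BiGraph.sum_edgeCoeff_sq h𝒢.1 h𝒢.2.1 hn (by omega)] at key
  have hN : 0 ≤ α₀ ^ 2 + ∑ G ∈ 𝒢, α G ^ 2 :=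
    add_nonneg (sq_nonneg _) (Finset.sum_nonneg fun G _ => sq_nonneg _)
  have hfin := abs_le.1 (key.trans (mul_le_mul_of_nonneg_right hbound hN))
  constructor <;> linarith [hfin.1, hfin.2]
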